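/- Let $b,s\in\mathbb R$ with $b\neq 0$ and $27s-38b^2>0$, and let $\mathbb T=\mathbb R/2\pi\mathbb Z$. For $\varepsilon>0$ and $\omega\in(-\tfrac12,\tfrac12)$, a *roll* is a nontrivial even $2\pi$-periodic $C^4$ function $u=u(x)$, $u:\mathbb R\to\mathbb R$, with $$-\big(1+(1+2\varepsilon\omega)\partial_x^2\big)^2u+\varepsilon^2u+bu^2-su^3=0 .$$ For a roll $u$ and $\sigma=(\sigma_1,\sigma_2)\in\mathbb R^2$ let $$B(\varepsilon,\omega,\sigma)=-\big[1+(1+2\varepsilon\omega)(\partial_x+i\sigma_1)^2-\sigma_2^2\big]^2+\varepsilon^2+2bu-3su^2$$ be the Bloch operator, acting on $L^2(\mathbb T)$ with domain $H^4(\mathbb T)$. An *unstable eigenvalue* is a positive eigenvalue. There is $\rho_0>0$ such that for every $\rho\in(0,\rho_0]$ and every $\varepsilon_0>0$ there is $\bar\varepsilon_0\in(0,\varepsilon_0]$ with the following property. For all $\varepsilon\in(0,\bar\varepsilon_0]$ and all $\omega\in(-\tfrac12,\tfrac12)$ there is a roll $u$ with $\sup|u|\le\rho$, and for every such roll: 1.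 there are $\bar\sigma\in\mathbb R^2$ and $\lambda_M>0$ such that $\lambda_M$ is an eigenvalue of $B(\varepsilon,\omega,\bar\sigma)$, and $\mu\le\lambda_M$ for every $\sigma\in\mathbb R^2$ and every unstable eigenvalue $\mu$ of $B(\varepsilon,\omega,\sigma)$; 2. there are an open neighborhood $\mathcal N\subset\mathbb R^2$ of $\bar\sigma$ and a real-analytic function $\lambda:\mathcal N\to\mathbb R$ such that $\lambda(\bar\sigma)=\lambda_M$ and, for each $\sigma\in\mathcal N$, $\lambda(\sigma)$ is an unstable eigenvalue of $B(\varepsilon,\omega,\sigma)$. -/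

import Mathlib

open MeasureTheory Set Topology
open scoped ENNReal Real

/-- `2π > 0`, so that the circle `ℝ / 2πℤ` has Haar measure and Fourier series. -/
instance instFactTwoPiPosRoll : Fact (0 < 2 * π) := ⟨Real.two_pi_pos⟩

/-- The torus `𝕋 = ℝ / 2πℤ`. -/
abbrev Torus : Type := AddCircle (2 * π)

/-- The complex Hilbert space `L²(𝕋)` (with normalized Haar measure). -/
abbrev L2Torus : Type := Lp ℂ 2 (AddCircle.haarAddCircle (T := 2 * π))

/-- The `n`-th Fourier coefficient of `f ∈ L²(𝕋)`, with respect to `x ↦ exp (i n x)`. -/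
noncomputable def torusCoeff (f : L2Torus) (n : ℤ) : ℂ := fourierBasis.repr f n

/-- The Sobolev space `H⁴(𝕋)`: the `f ∈ L²(𝕋)` for which `((1 + n²)² f̂(n))` is in `ℓ²(ℤ)`. -/
noncomputable def sobolevH4 : Submodule ℂ L2Torus where
  carrier := {f | Memℓp (fun n : ℤ => ((1 + (n : ℝ) ^ 2) ^ 2 : ℝ) • torusCoeff f n) 2}
  add_mem' := by
    intro f g hf hg
    have h := Memℓp.add hf hg
    refine (congrArg (fun c : ℤ → ℂ => Memℓp c 2) ?_).mp h
    funext n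
    simp [torusCoeff]
  zero_mem' := by
    refine (congrArg (fun c : ℤ → ℂ => Memℓp c 2) ?_).mp
      (zero_memℓp (E := fun _ : ℤ => ℂ) (p := 2))
    funext n
    simp [torusCoeff]
  smul_mem' := by
    intro c f hf
    have h := Memℓp.const_smul hf c
    refine (congrArg (fun c : ℤ → ℂ => Memℓp c 2) ?_).mp h
    funext n
    simp [torusCoeff]
    ring

/-- The Fourier symbol of `-[1 + (1 + 2εω)(∂ₓ + iσ₁)² - σ₂²]²`, where `∂ₓ` has symbol `i n`. -/
noncomputable def blochSymbol (ε ω : ℝ) (σ : ℝ × ℝ) (n : ℤ) : ℂ :=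
  -(1 + (1 + 2 * (ε : ℂ) * ω) * (Complex.I * n + Complex.I * σ.1) ^ 2 - (σ.2 : ℂ) ^ 2) ^ 2

theorem norm_blochSymbol_le (ε ω : ℝ) (σ : ℝ × ℝ) : ∃ C : ℝ, ∀ n : ℤ,
    ‖blochSymbol ε ω σ n‖ ≤ C * (1 + (n : ℝ) ^ 2) ^ 2 := by
  refine ⟨(1 + 2 * |1 + 2 * ε * ω| * (1 + σ.1 ^ 2) + σ.2 ^ 2) ^ 2, fun n => ?_⟩
  have h1 : blochSymbol ε ω σ n
      = ((-(1 - (1 + 2 * ε * ω) * (n + σ.1) ^ 2 - σ.2 ^ 2) ^ 2 : ℝ) : ℂ) := by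
    have h : (Complex.I * n + Complex.I * σ.1) ^ 2 = -((n : ℂ) + σ.1) ^ 2 := by
      rw [← mul_add, mul_pow, Complex.I_sq]; ring
    rw [blochSymbol, h]
    push_cast
    ring
  rw [h1, Complex.norm_real, Real.norm_eq_abs, abs_neg, abs_pow, ← mul_pow]
  refine pow_le_pow_left₀ (abs_nonneg _) ?_ 2
  have h2 : |(1 + 2 * ε * ω) * (n + σ.1) ^ 2|
      ≤ |1 + 2 * ε * ω| * (2 * ((1 + σ.1 ^ 2) * (1 + (n : ℝ) ^ 2))) := by
    rw [abs_mul, abs_of_nonneg (sq_nonneg ((n : ℝ) + σ.1))]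
    refine mul_le_mul_of_nonneg_left ?_ (abs_nonneg _)
    nlinarith [sq_nonneg ((n : ℝ) - σ.1), sq_nonneg ((n : ℝ) * σ.1)]
  have h3 := abs_le.mp h2
  have h4 : 0 ≤ σ.2 ^ 2 * (n : ℝ) ^ 2 := by positivity
  have h5 : 0 ≤ (n : ℝ) ^ 2 := by positivity
  have h6 : 0 ≤ σ.2 ^ 2 := by positivity
  rw [abs_le]
  constructor <;> nlinarith [h3.1, h3.2]

theorem memℓp_blochSymbol (ε ω : ℝ) (σ : ℝ × ℝ) (f : sobolevH4) :
    Memℓp (fun n : ℤ => blochSymbol ε ω σ n * torusCoeff f n) 2 := by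
  obtain ⟨C, hC⟩ := norm_blochSymbol_le ε ω σ
  have hf : Memℓp (fun n : ℤ => ((1 + (n : ℝ) ^ 2) ^ 2 : ℝ) • torusCoeff (f : L2Torus) n) 2 := f.2
  refine (Memℓp.const_smul hf C).mono' (fun n => ?_)
  have h0 : 0 ≤ (1 + (n : ℝ) ^ 2) ^ 2 := by positivity
  have hC' : 0 ≤ C := by simpa using (norm_nonneg _).trans (hC 0)
  rw [Pi.smul_apply, norm_mul, norm_smul, norm_smul, Real.norm_of_nonneg h0,
    Real.norm_of_nonneg hC', ← mul_assoc]
  exact mul_le_mul_of_nonneg_right (hC n) (norm_nonneg _)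

/-- The constant coefficient operator `-[1 + (1 + 2εω)(∂ₓ + iσ₁)² - σ₂²]²` from `H⁴(𝕋)` to
`L²(𝕋)`. -/
noncomputable def blochPrincipal (ε ω : ℝ) (σ : ℝ × ℝ) : sobolevH4 →ₗ[ℂ] L2Torus where
  toFun f := fourierBasis.repr.symm
    ⟨fun n : ℤ => blochSymbol ε ω σ n * torusCoeff f n, memℓp_blochSymbol ε ω σ f⟩
  map_add' f g := by
    rw [← map_add]
    congr 1
    ext n
    refine (congrArg (blochSymbol ε ω σ n * ·) ?_).trans (mul_add _ _ _)
    simp [torusCoeff]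
  map_smul' c f := by
    rw [RingHom.id_apply, ← map_smul]
    congr 1
    ext n
    simp [torusCoeff]
    ring

/-- The potential `ε² + 2bu - 3su²`, a continuous function on `𝕋`. -/
noncomputable def rollPotential (b s ε : ℝ) (u : C(Torus, ℝ)) : C(Torus, ℂ) :=
  ⟨fun x => ((ε ^ 2 + 2 * b * u x - 3 * s * u x ^ 2 : ℝ) : ℂ), by fun_prop⟩

/-- Multiplication by a continuous function on `L²(𝕋)`. -/
noncomputable def mulL2 (φ : C(Torus, ℂ)) : L2Torus →ₗ[ℂ] L2Torus where
  toFun f := (ContinuousMap.toLp ∞ AddCircle.haarAddCircle ℂ φ : Lp ℂ ∞ _) • f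
  map_add' f g := Lp.add_smul _ f g
  map_smul' c f := (Lp.smul_comm c _ f).symm

/-- The Bloch operator
`B(ε, ω, σ) = -[1 + (1 + 2εω)(∂ₓ + iσ₁)² - σ₂²]² + ε² + 2bu - 3su²`
linearized about the profile `u`, as an unbounded operator on `L²(𝕋)` with domain `H⁴(𝕋)`. -/
noncomputable def blochOperator (b s ε ω : ℝ) (u : C(Torus, ℝ)) (σ : ℝ × ℝ) :
    L2Torus →ₗ.[ℂ] L2Torus where
  domain := sobolevH4
  toFun := blochPrincipal ε ω σ + mulL2 (rollPotential b s ε u) ∘ₗ sobolevH4.subtype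

/-- `μ` is an unstable eigenvalue of the unbounded operator `A`: it is positive, and
`A W = μ W` for a nonzero `W` in the domain of `A`. -/
def IsUnstableEigenvalue (A : L2Torus →ₗ.[ℂ] L2Torus) (μ : ℝ) : Prop :=
  0 < μ ∧ ∃ W : A.domain, (W : L2Torus) ≠ 0 ∧ A W = (μ : ℂ) • (W : L2Torus)

/-- The differential operator `w ↦ w + κ w''` on functions of one real variable. -/
noncomputable def helmholtzOp (κ : ℝ) (w : ℝ → ℝ) : ℝ → ℝ :=
  fun x => w x + κ * iteratedDeriv 2 w x

/-- A roll: a nontrivial, even, `2π`-periodic, classical (`C⁴`) solution `u = u(x)` of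
`-(1 + (1 + 2εω) ∂ₓ²)² u + ε² u + b u² - s u³ = 0`. Periodicity is built in, as `u` is a
function on `ℝ / 2πℤ`. -/
structure IsRoll (b s ε ω : ℝ) (u : C(Torus, ℝ)) : Prop where
  contDiff : ContDiff ℝ 4 (fun x : ℝ => u (x : Torus))
  even : ∀ x : ℝ, u ((-x : ℝ) : Torus) = u (x : Torus)
  nontrivial : u ≠ 0
  stationary : ∀ x : ℝ,
    -helmholtzOp (1 + 2 * ε * ω) (helmholtzOp (1 + 2 * ε * ω) (fun y : ℝ => u (y : Torus))) x
      + ε ^ 2 * u (x : Torus) + b * u (x : Torus) ^ 2 - s * u (x : Torus) ^ 3 = 0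

/-!
Write `κ = 1 + 2εω`. By Lyapunov-Schmidt reduction a small roll is `u = 2a cos x + O(a²)`, and the
equation on the mode `cos x` reads `ε² - (1 - κ)² = (27s - 38b²)/9 · a² + o(a²)`: a pitchfork, which
gives the rolls.

For `b ≠ 0` the quadratic term alone destabilizes them. The potential `ε² + 2bu - 3su²` is
`ε² + 2t cos x + O(a²)` with `t = 2ab`, and multiplication by `2t cos x` couples neighbouring
Fourier modes. At `σ₁ = 1/2` and a suitable `σ₂` the modes `0` and `-1` are both exactly critical,
so some eigenvalue is at least `ε² + |t| - O(a²)`. Conversely, for every `σ` at most two modes are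
nearly critical, and on the hyperplane orthogonal to the favourable combination of them the
quadratic form of the Bloch operator is at most `ε² + O(a²)`.

A maximizer over `σ` exists because the spectrum is periodic in `σ₁` and the form tends to `-∞` as
`|σ₂| → ∞`; by the gap the maximal eigenvalue is simple, and it continues analytically by the
implicit function theorem, applied to a rank-one perturbation that makes the resolvent problem
invertible.
-/

section Hilbert

open InnerProductSpace Filter

variable {H : Type*} [NormedAddCommGroup H] [InnerProductSpace ℂ H]

theorem inner_self_eq_ofReal_norm_sq (x : H) : inner ℂ x x = ((‖x‖ ^ 2 : ℝ) : ℂ) := by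
  rw [inner_self_eq_norm_sq_to_K]
  norm_cast

theorem norm_add_sq_of_inner_eq_zero {x y : H} (h : inner ℂ x y = 0) :
    ‖x + y‖ ^ 2 = ‖x‖ ^ 2 + ‖y‖ ^ 2 := by
  simpa only [sq] using norm_add_sq_eq_norm_sq_add_norm_sq_of_inner_eq_zero x y h

theorem inner_map_left {A : H →L[ℂ] H} (hA : A.IsSymmetric) (x y : H) :
    inner ℂ (A x) y = inner ℂ x (A y) := hA x y

theorem abs_re_inner_map_le (A : H →L[ℂ] H) (x y : H) :
    |(inner ℂ (A x) y).re| ≤ ‖A‖ * ‖x‖ * ‖y‖ :=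
  calc |(inner ℂ (A x) y).re| ≤ ‖A x‖ * ‖y‖ :=
        (Complex.abs_re_le_norm _).trans (norm_inner_le_norm _ _)
    _ ≤ ‖A‖ * ‖x‖ * ‖y‖ := by gcongr; exact A.le_opNorm x

theorem re_inner_map_self_le (A : H →L[ℂ] H) (x : H) :
    (inner ℂ (A x) x).re ≤ ‖A‖ * ‖x‖ ^ 2 := by
  have := (le_abs_self _).trans (abs_re_inner_map_le A x x)
  rwa [mul_assoc, ← sq] at this

theorem re_inner_map_add_self_le (A : H →L[ℂ] H) (x y : H) :
    (inner ℂ (A (x + y)) (x + y)).re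
      ≤ (inner ℂ (A x) x).re + 2 * ‖A‖ * ‖x‖ * ‖y‖ + ‖A‖ * ‖y‖ ^ 2 := by
  have hxy := (le_abs_self _).trans (abs_re_inner_map_le A x y)
  have hyx := (le_abs_self _).trans (abs_re_inner_map_le A y x)
  have hyy := re_inner_map_self_le A y
  simp only [map_add, inner_add_left, inner_add_right, Complex.add_re]
  linarith

theorem re_inner_rankOne_self (k g : H) :
    (inner ℂ (rankOne ℂ k k g) g).re = ‖inner ℂ k g‖ ^ 2 := by
  rw [inner_left_rankOne_apply, ← inner_conj_symm, mul_comm, Complex.mul_conj, Complex.ofReal_re,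
    Complex.normSq_eq_norm_sq]

theorem apply_eq_zero_of_isPositive [CompleteSpace H] {A : H →L[ℂ] H} (hA : A.IsPositive) {g : H}
    (hg : (inner ℂ (A g) g).re = 0) : A g = 0 := by
  obtain ⟨S, rfl⟩ := CStarAlgebra.nonneg_iff_eq_star_mul_self.mp (A.nonneg_iff_isPositive.mpr hA)
  have hS : ‖S g‖ ^ 2 = 0 := by
    rw [← hg, mul_apply_eq_comp, ContinuousLinearMap.star_eq_adjoint,
      ContinuousLinearMap.adjoint_inner_left, inner_self_eq_ofReal_norm_sq, Complex.ofReal_re]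
  rw [mul_apply_eq_comp,
    norm_eq_zero.mp ((pow_eq_zero_iff two_ne_zero).mp hS), map_zero]

section Gap

variable {A W : H →L[ℂ] H} {g₀ : H} {γ : ℝ}

theorem inner_map_sub_smul_of_map_eq_zero (hA : A.IsSymmetric) (hg₀ : A g₀ = 0) (g : H) (z : ℂ) :
    inner ℂ (A (g - z • g₀)) (g - z • g₀) = inner ℂ (A g) g := by
  have h : A (g - z • g₀) = A g := by rw [map_sub, map_smul, hg₀, smul_zero, sub_zero]
  rw [h, inner_map_left hA, h, inner_map_left hA]

/-- Among all subspaces of codimension one, the orthogonal complement of `W² g₀` is the one on which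
a lower bound relative to the weight `W` is best. -/
theorem gap_on_orthogonal_of_gap_on_ker (hA : A.IsSymmetric) (hW : W.IsSymmetric) (hAg₀ : A g₀ = 0)
    (hWg₀ : W g₀ ≠ 0) (hγ : 0 < γ) (ℓ : H →ₗ[ℂ] ℂ)
    (hgap : ∀ g, ℓ g = 0 → γ * ‖W g‖ ^ 2 ≤ (inner ℂ (A g) g).re) {g : H}
    (hg : inner ℂ (W (W g₀)) g = 0) : γ * ‖W g‖ ^ 2 ≤ (inner ℂ (A g) g).re := by
  have hℓ : ℓ g₀ ≠ 0 := by
    intro h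
    have h0 := hgap g₀ h
    rw [hAg₀, inner_zero_left, Complex.zero_re] at h0
    have := norm_pos_iff.mpr hWg₀
    exact h0.not_gt (by positivity)
  set f := g - (ℓ g / ℓ g₀) • g₀
  have hf : ℓ f = 0 := by simp [f, hℓ]
  have hWgg₀ : inner ℂ (W g) (-((ℓ g / ℓ g₀) • W g₀)) = 0 := by
    have : inner ℂ (W g) (W g₀) = 0 := by
      rw [← inner_conj_symm, ← inner_map_left hW, hg, map_zero]
    rw [inner_neg_right, inner_smul_right, this, mul_zero, neg_zero]
  have hWf : ‖W g‖ ^ 2 ≤ ‖W f‖ ^ 2 := by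
    rw [map_sub, map_smul, sub_eq_add_neg, norm_add_sq_of_inner_eq_zero hWgg₀]
    exact le_add_of_nonneg_right (sq_nonneg _)
  calc γ * ‖W g‖ ^ 2 ≤ γ * ‖W f‖ ^ 2 := by gcongr
    _ ≤ (inner ℂ (A f) f).re := hgap f hf
    _ = _ := by rw [inner_map_sub_smul_of_map_eq_zero hA hAg₀]

theorem le_re_inner_add_rankOne (hA : A.IsSymmetric) (hW : W.IsSymmetric) (hAg₀ : A g₀ = 0)
    (hWg₀ : ‖W g₀‖ = 1)
    (hgap : ∀ g, inner ℂ (W (W g₀)) g = 0 → γ * ‖W g‖ ^ 2 ≤ (inner ℂ (A g) g).re) (g : H) :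
    min γ 1 * ‖W g‖ ^ 2
      ≤ (inner ℂ ((A + rankOne ℂ (W (W g₀)) (W (W g₀))) g) g).re := by
  set k := W (W g₀)
  set z := inner ℂ k g
  set h := g - z • g₀
  have hkg₀ : inner ℂ k g₀ = 1 := by
    rw [inner_map_left hW, inner_self_eq_ofReal_norm_sq, hWg₀]
    norm_num
  have hkh : inner ℂ k h = 0 := by
    rw [inner_sub_right, inner_smul_right, hkg₀, mul_one, sub_self]
  have hWhg₀ : inner ℂ (W h) (z • W g₀) = 0 := by
    rw [inner_smul_right, ← inner_conj_symm, ← inner_map_left hW, hkh, map_zero,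
      mul_zero]
  have hWg : ‖W g‖ ^ 2 = ‖W h‖ ^ 2 + ‖z‖ ^ 2 := by
    have := norm_add_sq_of_inner_eq_zero hWhg₀
    rwa [← map_smul, ← map_add, sub_add_cancel, map_smul, norm_smul, hWg₀, mul_one] at this
  calc min γ 1 * ‖W g‖ ^ 2 = min γ 1 * ‖W h‖ ^ 2 + min γ 1 * ‖z‖ ^ 2 := by rw [hWg, mul_add]
    _ ≤ γ * ‖W h‖ ^ 2 + 1 * ‖z‖ ^ 2 := by
        gcongr
        exacts [min_le_left _ _, min_le_right _ _]
    _ ≤ (inner ℂ (A h) h).re + ‖z‖ ^ 2 := by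
        rw [one_mul]
        gcongr
        exact hgap h hkh
    _ = _ := by
        rw [inner_map_sub_smul_of_map_eq_zero hA hAg₀, _root_.add_apply, inner_add_left,
          Complex.add_re, re_inner_rankOne_self]

/-- The last hypothesis is a Gårding inequality for `A` relative to the weight `W`. -/
theorem isUnit_add_rankOne [CompleteSpace H] (hA : A.IsSymmetric) (hW : W.IsSymmetric)
    (hAg₀ : A g₀ = 0) (hWg₀ : ‖W g₀‖ = 1) (hγ : 0 < γ)
    (hgap : ∀ g, inner ℂ (W (W g₀)) g = 0 → γ * ‖W g‖ ^ 2 ≤ (inner ℂ (A g) g).re)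
    {a b : ℝ} (ha : 0 ≤ a) (hb : 0 < b)
    (hgarding : ∀ g, ‖g‖ ^ 2 ≤ a * ‖W g‖ ^ 2 + b * (inner ℂ (A g) g).re) :
    IsUnit (A + rankOne ℂ (W (W g₀)) (W (W g₀))) := by
  set T := A + rankOne ℂ (W (W g₀)) (W (W g₀)) with hT
  have hm : 0 < min γ 1 := lt_min hγ one_pos
  have hcoercive : ∀ g, ‖g‖ ^ 2 ≤ (a / min γ 1 + b) * (inner ℂ (T g) g).re := by
    intro g
    have hWg : ‖W g‖ ^ 2 ≤ (inner ℂ (T g) g).re / min γ 1 := by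
      rw [le_div_iff₀ hm, mul_comm]
      exact le_re_inner_add_rankOne hA hW hAg₀ hWg₀ hgap g
    have hAg : (inner ℂ (A g) g).re ≤ (inner ℂ (T g) g).re := by
      rw [hT, _root_.add_apply, inner_add_left, Complex.add_re, re_inner_rankOne_self]
      exact le_add_of_nonneg_right (sq_nonneg _)
    calc ‖g‖ ^ 2 ≤ a * ‖W g‖ ^ 2 + b * (inner ℂ (A g) g).re := hgarding g
      _ ≤ a * ((inner ℂ (T g) g).re / min γ 1) + b * (inner ℂ (T g) g).re := by gcongr
      _ = _ := by ring
  have hc : 0 < (a / min γ 1 + b)⁻¹ := by positivity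
  refine T.isUnit_of_forall_le_norm_inner_map (c := ⟨_, hc.le⟩) hc fun g => ?_
  change ‖g‖ ^ 2 * (a / min γ 1 + b)⁻¹ ≤ _
  rw [← div_eq_mul_inv, div_le_iff₀' (by positivity)]
  exact (hcoercive g).trans (by gcongr; exact Complex.re_le_norm _)

end Gap

section AnalyticKernel

variable {A : H →L[ℂ] H} {k g₀ : H}

/-- The scalar `Re ⟪k, (A + k k*)⁻¹ k⟫` attached to the operator `A` bordered by the vector `k`. For
symmetric `A` the level set `1` of this function consists of operators with nontrivial kernel, which
turns the eigenvalue problem into a scalar analytic equation. -/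
noncomputable def borderedScalar (k : H) (A : H →L[ℂ] H) : ℝ :=
  (inner ℂ k (Ring.inverse (A + rankOne ℂ k k) k)).re

theorem analyticAt_borderedScalar [CompleteSpace H] (hu : IsUnit (A + rankOne ℂ k k)) :
    AnalyticAt ℝ (borderedScalar k) A := by
  let L : (H →L[ℂ] H) →L[ℝ] ℝ :=
    Complex.reCLM ∘L ((innerSL ℂ k) ∘L ContinuousLinearMap.apply ℂ H k).restrictScalars ℝ
  obtain ⟨U, hU⟩ := hu
  have hinv : AnalyticAt ℝ Ring.inverse (A + rankOne ℂ k k) := hU ▸ analyticAt_inverse (𝕜 := ℝ) U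
  exact (L.analyticAt _).comp
    (hinv.comp (f := fun B : H →L[ℂ] H => B + rankOne ℂ k k) (analyticAt_id.add analyticAt_const))

theorem exists_ne_zero_of_borderedScalar_eq_one (hA : A.IsSymmetric)
    (hu : IsUnit (A + rankOne ℂ k k)) (h : borderedScalar k A = 1) : ∃ g, g ≠ 0 ∧ A g = 0 := by
  set T := A + rankOne ℂ k k
  set z := Ring.inverse T k
  have hT : (T : H →ₗ[ℂ] H).IsSymmetric := hA.add (isSymmetric_rankOne_self k)
  have hTz : T z = k := congrArg (fun B : H →L[ℂ] H => B k) (Ring.mul_inverse_cancel _ hu)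
  have him : (inner ℂ k z).im = 0 := by
    rw [← hTz]
    exact hT.im_inner_apply_self z
  have hkz : inner ℂ k z = 1 := Complex.ext h him
  refine ⟨z, ?_, ?_⟩
  · intro hz
    rw [hz, inner_zero_right] at hkz
    exact zero_ne_one hkz
  · have : A z + inner ℂ k z • k = k := hTz
    rwa [hkz, one_smul, add_eq_right] at this

theorem borderedScalar_eq_inv {c : ℝ} (hAg₀ : A g₀ = (c : ℂ) • k) (hkg₀ : inner ℂ k g₀ = 1)
    (hu : IsUnit (A + rankOne ℂ k k)) : borderedScalar k A = (1 + c)⁻¹ := by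
  set T := A + rankOne ℂ k k
  have hTg₀ : T g₀ = (1 + c : ℂ) • k := by
    change A g₀ + inner ℂ k g₀ • k = _
    rw [hAg₀, hkg₀]
    module
  have hinv : Ring.inverse T (T g₀) = g₀ :=
    congrArg (fun B : H →L[ℂ] H => B g₀) (Ring.inverse_mul_cancel _ hu)
  have hscalar : (1 + c : ℂ) * inner ℂ k (Ring.inverse T k) = 1 := by
    rw [← inner_smul_right, ← map_smul, ← hTg₀, hinv, hkg₀]
  change (inner ℂ k (Ring.inverse T k)).re = _
  rw [eq_inv_of_mul_eq_one_right hscalar, ← Complex.ofReal_one, ← Complex.ofReal_add,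
    ← Complex.ofReal_inv, Complex.ofReal_re]

theorem exists_analyticAt_implicit {E : Type*} [NormedAddCommGroup E] [NormedSpace ℝ E]
    [CompleteSpace E] {f : E × ℝ → ℝ} {x₀ : E} {y₀ f' : ℝ} (hf : AnalyticAt ℝ f (x₀, y₀))
    (hderiv : HasDerivAt (fun y => f (x₀, y)) f' y₀) (hf' : f' ≠ 0) :
    ∃ y : E → ℝ, AnalyticAt ℝ y x₀ ∧ y x₀ = y₀ ∧ ∀ᶠ x in 𝓝 x₀, f (x, y x) = f (x₀, y₀) := by
  have hcd : ContDiffAt ℝ (⊤ : WithTop ℕ∞) f (x₀, y₀) := hf.contDiffAt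
  have hinv : (fderiv ℝ f (x₀, y₀) ∘L .inr ℝ E ℝ).IsInvertible := by
    have h : HasFDerivAt (fun y => f (x₀, y)) (fderiv ℝ f (x₀, y₀) ∘L .inr ℝ E ℝ) y₀ :=
      hf.differentiableAt.hasFDerivAt.comp y₀ (hasFDerivAt_prodMk_right x₀ y₀)
    rw [h.unique hderiv.hasFDerivAt]
    exact ⟨ContinuousLinearEquiv.unitsEquivAut ℝ (Units.mk0 f' hf'), by ext; simp⟩
  exact ⟨hcd.implicitFunction (by simp) hinv,
    (hcd.contDiffAt_implicitFunction (by simp) hinv).analyticAt,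
    hcd.implicitFunction_apply_self (by simp) hinv,
    hcd.eventually_apply_implicitFunction (by simp) hinv⟩

theorem exists_analyticAt_kernel [CompleteSpace H] {E : Type*} [NormedAddCommGroup E]
    [NormedSpace ℝ E] [CompleteSpace E] {A : E × ℝ → H →L[ℂ] H} {σ₀ : E} {lam₀ : ℝ}
    (hA : AnalyticAt ℝ A (σ₀, lam₀)) (hsymm : ∀ p, (A p).IsSymmetric) (hkg₀ : inner ℂ k g₀ = 1)
    (hAg₀ : ∀ μ : ℝ, A (σ₀, μ) g₀ = ((μ - lam₀ : ℝ) : ℂ) • k)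
    (hu : IsUnit (A (σ₀, lam₀) + rankOne ℂ k k)) :
    ∃ lam : E → ℝ, AnalyticAt ℝ lam σ₀ ∧ lam σ₀ = lam₀ ∧
      ∀ᶠ σ in 𝓝 σ₀, ∃ g, g ≠ 0 ∧ A (σ, lam σ) g = 0 := by
  have hunit : ∀ᶠ p in 𝓝 (σ₀, lam₀), IsUnit (A p + rankOne ℂ k k) :=
    (hA.continuousAt.add continuousAt_const).eventually (Units.isOpen.mem_nhds hu)
  have hf : AnalyticAt ℝ (borderedScalar k ∘ A) (σ₀, lam₀) := (analyticAt_borderedScalar hu).comp hA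
  have hline : ∀ᶠ μ in 𝓝 lam₀, borderedScalar k (A (σ₀, μ)) = (1 + (μ - lam₀))⁻¹ :=
    ((Continuous.prodMk_right σ₀).continuousAt.eventually hunit).mono
      fun μ hμ => borderedScalar_eq_inv (hAg₀ μ) hkg₀ hμ
  have hderiv : HasDerivAt (fun μ => borderedScalar k (A (σ₀, μ))) (-1) lam₀ := by
    have h : HasDerivAt (fun μ : ℝ => 1 + (μ - lam₀)) 1 lam₀ :=
      ((hasDerivAt_id lam₀).sub_const lam₀).const_add 1
    exact ((h.inv (by simp)).congr_deriv (by simp)).congr_of_eventuallyEq hline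
  obtain ⟨lam, hlam, hlam₀, heq⟩ := exists_analyticAt_implicit hf hderiv (by norm_num)
  have htendsto : Tendsto (fun σ => (σ, lam σ)) (𝓝 σ₀) (𝓝 (σ₀, lam₀)) := by
    rw [← hlam₀]
    exact continuousAt_id.prodMk hlam.continuousAt
  refine ⟨lam, hlam, hlam₀, ?_⟩
  filter_upwards [heq, htendsto.eventually hunit] with σ hσ hσu
  refine exists_ne_zero_of_borderedScalar_eq_one (hsymm _) hσu (hσ.trans ?_)
  rw [Function.comp_apply, hline.self_of_nhds, sub_self, add_zero, inv_one]

end AnalyticKernel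

end Hilbert
section SequenceSpace

open Filter

/-- The Hilbert space `ℓ²(ℤ)` of Fourier coefficients. -/
abbrev SeqSpace : Type := lp (fun _ : ℤ => ℂ) 2

theorem hasSum_norm_sq_seq (g : SeqSpace) : HasSum (fun n => ‖g n‖ ^ 2) (‖g‖ ^ 2) := by
  simpa using lp.hasSum_norm (p := 2) (by simp) g

theorem norm_sq_le_of_forall_le {f g h : SeqSpace} {A B : ℝ}
    (H : ∀ n, ‖f n‖ ^ 2 ≤ A * ‖g n‖ ^ 2 + B * ‖h n‖ ^ 2) :
    ‖f‖ ^ 2 ≤ A * ‖g‖ ^ 2 + B * ‖h‖ ^ 2 :=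
  hasSum_le H (hasSum_norm_sq_seq f)
    (((hasSum_norm_sq_seq g).mul_left A).add ((hasSum_norm_sq_seq h).mul_left B))

theorem norm_sq_le_mul_of_forall_le {f g : SeqSpace} {A : ℝ}
    (H : ∀ n, ‖f n‖ ^ 2 ≤ A * ‖g n‖ ^ 2) : ‖f‖ ^ 2 ≤ A * ‖g‖ ^ 2 :=
  hasSum_le H (hasSum_norm_sq_seq f) ((hasSum_norm_sq_seq g).mul_left A)

theorem exists_subseq_tendsto_seq {X : Type*} [TopologicalSpace X] [FirstCountableTopology X]
    {K : Set X} (hK : IsCompact K) {R : ℝ} {σ : ℕ → X} {g : ℕ → SeqSpace} (hσ : ∀ j, σ j ∈ K)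
    (hg : ∀ j, ‖g j‖ ≤ R) :
    ∃ σ₀ ∈ K, ∃ (g₀ : SeqSpace) (φ : ℕ → ℕ), StrictMono φ ∧
      Tendsto (σ ∘ φ) atTop (𝓝 σ₀) ∧ ∀ n, Tendsto (fun j => g (φ j) n) atTop (𝓝 (g₀ n)) := by
  have hball : IsCompact (univ.pi fun _ : ℤ => Metric.closedBall (0 : ℂ) R) :=
    isCompact_univ_pi fun _ => isCompact_closedBall _ _
  have hmem : ∀ j, (((g j : SeqSpace) : ℤ → ℂ), σ j) ∈
      (univ.pi fun _ : ℤ => Metric.closedBall (0 : ℂ) R) ×ˢ K := by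
    refine fun j => ⟨fun n _ => ?_, hσ j⟩
    rw [mem_closedBall_zero_iff]
    exact (lp.norm_apply_le_norm two_ne_zero _ n).trans (hg j)
  obtain ⟨⟨G, σ₀⟩, hG, φ, hφ, hlim⟩ := (hball.prod hK).tendsto_subseq hmem
  have hlimG : Tendsto (fun j => ((g (φ j) : SeqSpace) : ℤ → ℂ)) atTop (𝓝 G) :=
    (continuous_fst.tendsto _).comp hlim
  have hbdd : Bornology.IsBounded (range fun j => g (φ j)) :=
    isBounded_iff_forall_norm_le.mpr ⟨R, forall_mem_range.mpr fun j => hg (φ j)⟩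
  exact ⟨σ₀, hG.2, ⟨G, lp.memℓp_of_tendsto hbdd hlimG⟩, φ, hφ, (continuous_snd.tendsto _).comp hlim,
    fun n => (continuous_apply n).continuousAt.tendsto.comp hlimG⟩

/-- The diagonal operator on `ℓ²(ℤ)` with real entries `d n`; the bound `C` only serves to make it
continuous. -/
noncomputable def diagOp (d : ℤ → ℝ) (C : ℝ) (hd : ∀ n, |d n| ≤ C) : SeqSpace →L[ℂ] SeqSpace :=
  LinearMap.mkContinuous
    { toFun := fun g => ⟨fun n => (d n : ℂ) * g n, by
        refine (Memℓp.const_smul (lp.memℓp g) C).mono' fun n => ?_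
        rw [norm_mul, Pi.smul_apply, norm_smul, Complex.norm_real, Real.norm_eq_abs]
        exact mul_le_mul_of_nonneg_right ((hd n).trans (le_abs_self C)) (norm_nonneg _)⟩
      map_add' := fun f g => by ext n; exact mul_add _ _ _
      map_smul' := fun c f => by ext n; exact mul_left_comm _ _ _ } C (fun g => by
        have hC : 0 ≤ C := (abs_nonneg _).trans (hd 0)
        refine le_of_sq_le_sq ?_ (by positivity)
        rw [mul_pow]
        refine norm_sq_le_mul_of_forall_le fun n => ?_
        simp only [LinearMap.coe_mk, AddHom.coe_mk, norm_mul, Complex.norm_real, Real.norm_eq_abs,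
          mul_pow]
        gcongr
        exact hd n)

theorem isSymmetric_of_forall_apply_eq {T : SeqSpace →L[ℂ] SeqSpace} {d : ℤ → ℝ}
    (hT : ∀ g n, T g n = (d n : ℂ) * g n) : T.IsSymmetric := by
  intro f g
  change inner ℂ (T f) g = inner ℂ f (T g)
  rw [lp.inner_eq_tsum, lp.inner_eq_tsum]
  congr 1
  funext n
  rw [hT, hT, ← smul_eq_mul, ← smul_eq_mul, inner_smul_left, inner_smul_right, Complex.conj_ofReal]

theorem one_add_sq_pos (n : ℤ) : (0 : ℝ) < 1 + (n : ℝ) ^ 2 := by positivity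

theorem inv_one_add_sq_nonneg (n : ℤ) : 0 ≤ (1 + (n : ℝ) ^ 2)⁻¹ :=
  (inv_pos.mpr (one_add_sq_pos n)).le

theorem inv_one_add_sq_le_one (n : ℤ) : (1 + (n : ℝ) ^ 2)⁻¹ ≤ 1 :=
  inv_le_one_of_one_le₀ (le_add_of_nonneg_right (sq_nonneg _))

theorem summable_inv_one_add_sq : Summable fun n : ℤ => (1 + (n : ℝ) ^ 2)⁻¹ := by
  have h : Summable fun n : ℤ => 1 / (n : ℝ) ^ 2 :=
    Real.summable_one_div_int_pow.mpr one_lt_two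
  refine h.of_norm_bounded_eventually ?_
  filter_upwards [(Set.finite_singleton (0 : ℤ)).compl_mem_cofinite] with n hn
  have hn' : (n : ℝ) ≠ 0 := by exact_mod_cast hn
  rw [Real.norm_of_nonneg (inv_one_add_sq_nonneg n), one_div]
  gcongr
  exact le_add_of_nonneg_left zero_le_one

theorem summable_inv_one_add_sq_sq : Summable fun n : ℤ => ((1 + (n : ℝ) ^ 2)⁻¹) ^ 2 :=
  summable_inv_one_add_sq.of_nonneg_of_le (fun _ => sq_nonneg _) fun n =>
    pow_le_of_le_one (inv_one_add_sq_nonneg n) (inv_one_add_sq_le_one n) two_ne_zero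

/-- The weight operator `diag (1 / (1 + n²))`. Writing `f = weightOp g` identifies the elements `f`
with `∑ (1 + n²)² |f n|² < ∞` with arbitrary elements `g` of `ℓ²(ℤ)`. -/
noncomputable def weightOp : SeqSpace →L[ℂ] SeqSpace :=
  diagOp (fun n => (1 + (n : ℝ) ^ 2)⁻¹) 1 fun n => by
    rw [abs_of_nonneg (inv_one_add_sq_nonneg n)]
    exact inv_one_add_sq_le_one n

@[simp] theorem weightOp_apply (g : SeqSpace) (n : ℤ) :
    weightOp g n = ((1 + (n : ℝ) ^ 2)⁻¹ : ℝ) * g n := rfl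

theorem isSymmetric_weightOp : weightOp.IsSymmetric := isSymmetric_of_forall_apply_eq weightOp_apply

theorem weightOp_injective : Function.Injective weightOp := by
  intro f g h
  ext n
  have hn : (1 + (n : ℂ) ^ 2) ≠ 0 := by exact_mod_cast (one_add_sq_pos n).ne'
  simpa [hn] using congrArg (fun x : SeqSpace => x n) h

theorem tendsto_weightOp_of_pointwise {g : ℕ → SeqSpace} {g₀ : SeqSpace} {R : ℝ}
    (hR : ∀ j, ‖g j‖ ≤ R) (h : ∀ n, Tendsto (fun j => g j n) atTop (𝓝 (g₀ n))) :
    Tendsto (fun j => weightOp (g j)) atTop (𝓝 (weightOp g₀)) := by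
  have hb : ∀ j n, ‖g j n‖ ≤ R :=
    fun j n => (lp.norm_apply_le_norm two_ne_zero _ n).trans (hR j)
  have hb0 : ∀ n, ‖g₀ n‖ ≤ R := fun n => le_of_tendsto' (h n).norm fun j => hb j n
  have hsum : Tendsto (fun j => ∑' n, ‖weightOp (g j - g₀) n‖ ^ 2) atTop
      (𝓝 (∑' _ : ℤ, (0 : ℝ))) := by
    refine tendsto_tsum_of_dominated_convergence
      (summable_inv_one_add_sq_sq.mul_right ((2 * R) ^ 2)) (fun n => ?_) (.of_forall fun j n => ?_)
    · have hn : Tendsto (fun j => weightOp (g j - g₀) n) atTop (𝓝 0) := by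
        have := ((h n).sub_const (g₀ n)).const_mul (((1 + (n : ℝ) ^ 2)⁻¹ : ℝ) : ℂ)
        simpa [mul_sub] using this
      simpa [mul_sub] using hn.norm.pow 2
    · rw [Real.norm_of_nonneg (sq_nonneg _), weightOp_apply, norm_mul, mul_pow,
        Complex.norm_real, Real.norm_of_nonneg (inv_one_add_sq_nonneg n)]
      gcongr
      calc ‖(g j - g₀) n‖ ≤ ‖g j n‖ + ‖g₀ n‖ := by simpa using norm_sub_le (g j n) (g₀ n)
        _ ≤ 2 * R := by linarith [hb j n, hb0 n]
  rw [tendsto_iff_norm_sub_tendsto_zero]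
  simp only [tsum_zero, (hasSum_norm_sq_seq _).tsum_eq] at hsum
  simpa [Real.sqrt_sq] using hsum.sqrt

/-- The operator `diag (n / (1 + n²))`. -/
noncomputable def firstOrderOp : SeqSpace →L[ℂ] SeqSpace :=
  diagOp (fun n => n * (1 + (n : ℝ) ^ 2)⁻¹) 1 fun n => by
    rw [← div_eq_mul_inv, abs_div, abs_of_nonneg (one_add_sq_pos n).le,
      div_le_one (one_add_sq_pos n)]
    nlinarith [sq_abs (n : ℝ), abs_nonneg (n : ℝ), sq_nonneg (|(n : ℝ)| - 1)]

/-- The dispersion relation `1 - κ (n + σ₁)² - σ₂²`: the symbol of `1 + κ (∂ₓ + iσ₁)² - σ₂²`. -/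
def dispersion (κ : ℝ) (σ : ℝ × ℝ) (n : ℤ) : ℝ := 1 - κ * (n + σ.1) ^ 2 - σ.2 ^ 2

/-- The operator `diag ((1 - κ (n + σ₁)² - σ₂²) / (1 + n²))`, written as a polynomial in `σ` with
bounded coefficients so that its analyticity in `σ` is evident. -/
noncomputable def dispersionOp (κ : ℝ) (σ : ℝ × ℝ) : SeqSpace →L[ℂ] SeqSpace :=
  (1 - κ * σ.1 ^ 2 - σ.2 ^ 2) • weightOp - (2 * κ * σ.1) • firstOrderOp - κ • (1 - weightOp)

theorem dispersionOp_apply (κ : ℝ) (σ : ℝ × ℝ) (g : SeqSpace) (n : ℤ) :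
    dispersionOp κ σ g n = (dispersion κ σ n : ℂ) * weightOp g n := by
  have hn : (1 + (n : ℂ) ^ 2) ≠ 0 := by exact_mod_cast (one_add_sq_pos n).ne'
  change ((1 - κ * σ.1 ^ 2 - σ.2 ^ 2 : ℝ) • weightOp g n
    - (2 * κ * σ.1 : ℝ) • (((n * (1 + (n : ℝ) ^ 2)⁻¹ : ℝ) : ℂ) * g n)
    - κ • (g n - weightOp g n) : ℂ) = _
  simp only [dispersion, weightOp_apply, Complex.real_smul]
  push_cast
  field_simp
  ring

theorem norm_dispersionOp_apply (κ : ℝ) (σ : ℝ × ℝ) (g : SeqSpace) (n : ℤ) :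
    ‖dispersionOp κ σ g n‖ = |dispersion κ σ n| * ‖weightOp g n‖ := by
  rw [dispersionOp_apply, norm_mul, Complex.norm_real, Real.norm_eq_abs]

theorem isSymmetric_dispersionOp (κ : ℝ) (σ : ℝ × ℝ) : (dispersionOp κ σ).IsSymmetric := by
  refine isSymmetric_of_forall_apply_eq (d := fun n => dispersion κ σ n * (1 + (n : ℝ) ^ 2)⁻¹) ?_
  intro g n
  rw [dispersionOp_apply, weightOp_apply, Complex.ofReal_mul, mul_assoc]

theorem one_add_sq_le_dispersion {κ : ℝ} (hκ : 3 / 4 ≤ κ) (σ : ℝ × ℝ) (n : ℤ) :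
    1 + (n : ℝ) ^ 2 ≤ (4 + 2 * σ.1 ^ 2) * (1 + |dispersion κ σ n|) := by
  have hκn : κ * ((n : ℝ) + σ.1) ^ 2 ≤ 1 + |dispersion κ σ n| := by
    have := neg_abs_le (dispersion κ σ n)
    simp only [dispersion] at this ⊢
    nlinarith [sq_nonneg σ.2]
  have hn : (3 / 4) * ((n : ℝ) + σ.1) ^ 2 ≤ κ * ((n : ℝ) + σ.1) ^ 2 := by gcongr
  have hd : 0 ≤ |dispersion κ σ n| := abs_nonneg _
  nlinarith [sq_nonneg ((n : ℝ) + 2 * σ.1), mul_nonneg (sq_nonneg σ.1) hd]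

theorem norm_sq_le_dispersionOp {κ : ℝ} (hκ : 3 / 4 ≤ κ) (σ : ℝ × ℝ) (g : SeqSpace) :
    ‖g‖ ^ 2 ≤ 2 * (4 + 2 * σ.1 ^ 2) ^ 2 * (‖weightOp g‖ ^ 2 + ‖dispersionOp κ σ g‖ ^ 2) := by
  rw [mul_add]
  refine norm_sq_le_of_forall_le fun n => ?_
  have hgn : ‖g n‖ = (1 + (n : ℝ) ^ 2) * ‖weightOp g n‖ := by
    rw [weightOp_apply, norm_mul, Complex.norm_real, Real.norm_of_nonneg (inv_one_add_sq_nonneg n),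
      mul_inv_cancel_left₀ (one_add_sq_pos n).ne']
  have hle : ‖g n‖ ≤ (4 + 2 * σ.1 ^ 2) * (‖weightOp g n‖ + ‖dispersionOp κ σ g n‖) := by
    rw [hgn, norm_dispersionOp_apply]
    nlinarith [mul_le_mul_of_nonneg_right (one_add_sq_le_dispersion hκ σ n)
      (norm_nonneg (weightOp g n))]
  calc ‖g n‖ ^ 2 ≤ ((4 + 2 * σ.1 ^ 2) * (‖weightOp g n‖ + ‖dispersionOp κ σ g n‖)) ^ 2 := by gcongr
    _ ≤ (4 + 2 * σ.1 ^ 2) ^ 2 * (2 * (‖weightOp g n‖ ^ 2 + ‖dispersionOp κ σ g n‖ ^ 2)) := by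
      rw [mul_pow]
      gcongr
      exact add_sq_le
    _ = _ := by ring

theorem tendsto_dispersionOp_apply {κ : ℝ} {σ : ℕ → ℝ × ℝ} {σ₀ : ℝ × ℝ} {g : ℕ → SeqSpace}
    {g₀ : SeqSpace} (hσ : Tendsto σ atTop (𝓝 σ₀)) {n : ℤ}
    (hg : Tendsto (fun j => g j n) atTop (𝓝 (g₀ n))) :
    Tendsto (fun j => dispersionOp κ (σ j) (g j) n) atTop (𝓝 (dispersionOp κ σ₀ g₀ n)) := by
  simp only [dispersionOp_apply, weightOp_apply]
  have hcont : Continuous fun σ : ℝ × ℝ => (dispersion κ σ n : ℂ) := by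
    unfold dispersion
    fun_prop
  exact ((hcont.tendsto _).comp hσ).mul (hg.const_mul _)

end SequenceSpace
section Pencil

open Filter

/-- The operator `W (μ - B(σ)) W`, where `p = (σ, μ)`, `W` is the weight and
`B(σ) = V - diag (dispersion²)`; it is bounded, and polynomial in `p`. -/
noncomputable def pencil (κ : ℝ) (V : SeqSpace →L[ℂ] SeqSpace) (p : (ℝ × ℝ) × ℝ) :
    SeqSpace →L[ℂ] SeqSpace :=
  p.2 • (weightOp * weightOp) + dispersionOp κ p.1 * dispersionOp κ p.1 - weightOp * V * weightOp

/-- The quadratic form of `B(σ) = V - diag (dispersion²)` at the point `weightOp g` of its form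
domain. -/
noncomputable def rayleighForm (κ : ℝ) (V : SeqSpace →L[ℂ] SeqSpace) (σ : ℝ × ℝ) (g : SeqSpace) :
    ℝ :=
  (inner ℂ (V (weightOp g)) (weightOp g)).re - ‖dispersionOp κ σ g‖ ^ 2

variable {κ : ℝ} {V : SeqSpace →L[ℂ] SeqSpace} {σ : ℝ × ℝ} {g : SeqSpace}

theorem pencil_apply (κ : ℝ) (V : SeqSpace →L[ℂ] SeqSpace) (p : (ℝ × ℝ) × ℝ) (g : SeqSpace) :
    pencil κ V p g = (p.2 : ℂ) • weightOp (weightOp g) + dispersionOp κ p.1 (dispersionOp κ p.1 g)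
      - weightOp (V (weightOp g)) := rfl

theorem isSymmetric_pencil (hV : V.IsSymmetric) (p : (ℝ × ℝ) × ℝ) :
    (pencil κ V p).IsSymmetric := by
  intro f g
  change inner ℂ (pencil κ V p f) g = inner ℂ f (pencil κ V p g)
  simp only [pencil_apply, inner_add_left, inner_sub_left, inner_add_right, inner_sub_right,
    inner_map_left isSymmetric_weightOp, inner_map_left (isSymmetric_dispersionOp _ _),
    inner_map_left hV, inner_smul_left, inner_smul_right, Complex.conj_ofReal]

theorem analyticAt_pencil (p : (ℝ × ℝ) × ℝ) : AnalyticAt ℝ (pencil κ V) p := by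
  have : ContDiff ℝ (⊤ : WithTop ℕ∞) (pencil κ V) := by
    unfold pencil dispersionOp
    fun_prop
  exact this.contDiffAt.analyticAt

theorem re_inner_pencil (σ : ℝ × ℝ) (lam : ℝ) (g : SeqSpace) :
    (inner ℂ (pencil κ V (σ, lam) g) g).re = lam * ‖weightOp g‖ ^ 2 - rayleighForm κ V σ g := by
  rw [pencil_apply, inner_sub_left, inner_add_left, inner_smul_left, Complex.conj_ofReal,
    inner_map_left isSymmetric_weightOp (weightOp g),
    inner_map_left (isSymmetric_dispersionOp _ _) (dispersionOp κ σ g),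
    inner_map_left isSymmetric_weightOp (V (weightOp g)), inner_self_eq_ofReal_norm_sq,
    inner_self_eq_ofReal_norm_sq, Complex.sub_re, Complex.add_re, Complex.re_ofReal_mul,
    Complex.ofReal_re, Complex.ofReal_re, rayleighForm]
  ring

theorem rayleighForm_smul (r : ℝ) :
    rayleighForm κ V σ ((r : ℂ) • g) = r ^ 2 * rayleighForm κ V σ g := by
  simp only [rayleighForm, map_smul, inner_smul_left, inner_smul_right, Complex.conj_ofReal,
    norm_smul, Complex.norm_real, Complex.re_ofReal_mul, mul_pow, Real.norm_eq_abs, sq_abs]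
  ring

theorem rayleighForm_le :
    rayleighForm κ V σ g ≤ ‖V‖ * ‖weightOp g‖ ^ 2 - ‖dispersionOp κ σ g‖ ^ 2 :=
  sub_le_sub_right (re_inner_map_self_le V _) _

theorem norm_sq_le_pencil (hκ : 3 / 4 ≤ κ) {lam : ℝ} (hlam : 0 ≤ lam) :
    ‖g‖ ^ 2 ≤ 2 * (4 + 2 * σ.1 ^ 2) ^ 2 * (1 + ‖V‖) * ‖weightOp g‖ ^ 2
      + 2 * (4 + 2 * σ.1 ^ 2) ^ 2 * (inner ℂ (pencil κ V (σ, lam) g) g).re := by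
  have hY : ‖dispersionOp κ σ g‖ ^ 2
      ≤ ‖V‖ * ‖weightOp g‖ ^ 2 + (inner ℂ (pencil κ V (σ, lam) g) g).re := by
    have := rayleighForm_le (κ := κ) (V := V) (σ := σ) (g := g)
    have : 0 ≤ lam * ‖weightOp g‖ ^ 2 := by positivity
    rw [re_inner_pencil]
    linarith
  calc ‖g‖ ^ 2 ≤ 2 * (4 + 2 * σ.1 ^ 2) ^ 2 * (‖weightOp g‖ ^ 2 + ‖dispersionOp κ σ g‖ ^ 2) :=
        norm_sq_le_dispersionOp hκ σ g
    _ ≤ 2 * (4 + 2 * σ.1 ^ 2) ^ 2 * (‖weightOp g‖ ^ 2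
        + (‖V‖ * ‖weightOp g‖ ^ 2 + (inner ℂ (pencil κ V (σ, lam) g) g).re)) := by gcongr
    _ = _ := by ring

section Maximizer

theorem norm_dispersionOp_sq_le (hF : 0 ≤ rayleighForm κ V σ g) (hg : ‖weightOp g‖ = 1) :
    ‖dispersionOp κ σ g‖ ^ 2 ≤ ‖V‖ := by
  have := hF.trans rayleighForm_le
  rw [hg] at this
  linarith

theorem norm_le_of_rayleighForm_nonneg (hκ : 3 / 4 ≤ κ) (hσ : σ.1 ∈ Icc (0 : ℝ) 1)
    (hF : 0 ≤ rayleighForm κ V σ g) (hg : ‖weightOp g‖ = 1) : ‖g‖ ≤ 72 * (1 + ‖V‖) := by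
  have hσ₁ : σ.1 ^ 2 ≤ 1 := pow_le_one₀ hσ.1 hσ.2
  have hY := norm_dispersionOp_sq_le hF hg
  have hsq : ‖g‖ ^ 2 ≤ 72 * (1 + ‖V‖) :=
    calc ‖g‖ ^ 2 ≤ 2 * (4 + 2 * σ.1 ^ 2) ^ 2 * (‖weightOp g‖ ^ 2 + ‖dispersionOp κ σ g‖ ^ 2) :=
          norm_sq_le_dispersionOp hκ σ g
      _ ≤ 2 * (4 + 2 * 1) ^ 2 * (1 ^ 2 + ‖V‖) := by rw [hg]; gcongr
      _ = 72 * (1 + ‖V‖) := by ring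
  nlinarith [norm_nonneg g, norm_nonneg V]

theorem sq_le_norm_dispersionOp_sq (hκ : 0 ≤ κ) {r : ℝ} (hr : 0 ≤ r) (hσ : 1 + r ≤ σ.2 ^ 2) :
    r ^ 2 * ‖weightOp g‖ ^ 2 ≤ ‖dispersionOp κ σ g‖ ^ 2 := by
  rcases hr.eq_or_lt with rfl | hr
  · simp
  rw [← le_div_iff₀' (by positivity), div_eq_inv_mul]
  refine norm_sq_le_mul_of_forall_le fun n => ?_
  have hdisp : r ≤ |dispersion κ σ n| := by
    have : 0 ≤ κ * ((n : ℝ) + σ.1) ^ 2 := by positivity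
    rw [le_abs, dispersion]
    right
    linarith
  rw [← div_eq_inv_mul, le_div_iff₀' (by positivity), norm_dispersionOp_apply, mul_pow]
  gcongr

theorem abs_snd_le_of_rayleighForm_nonneg (hκ : 0 ≤ κ) (hF : 0 ≤ rayleighForm κ V σ g)
    (hg : ‖weightOp g‖ = 1) : |σ.2| ≤ 2 + ‖V‖ := by
  by_contra! hlt
  have hV := norm_nonneg V
  have hσ : 1 + (1 + ‖V‖) ≤ σ.2 ^ 2 := by
    rw [← sq_abs]
    nlinarith
  have hY := sq_le_norm_dispersionOp_sq (g := g) hκ (by positivity) hσ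
  rw [hg] at hY
  nlinarith [norm_dispersionOp_sq_le hF hg]

theorem le_rayleighForm_of_tendsto {σ : ℕ → ℝ × ℝ} {σ₀ : ℝ × ℝ} {g : ℕ → SeqSpace}
    {g₀ : SeqSpace} {R L : ℝ} (hσ : Tendsto σ atTop (𝓝 σ₀)) (hR : ∀ j, ‖g j‖ ≤ R)
    (hg : ∀ n, Tendsto (fun j => g j n) atTop (𝓝 (g₀ n)))
    (hF : Tendsto (fun j => rayleighForm κ V (σ j) (g j)) atTop (𝓝 L)) :
    L ≤ rayleighForm κ V σ₀ g₀ := by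
  set v := (inner ℂ (V (weightOp g₀)) (weightOp g₀)).re
  have hW := tendsto_weightOp_of_pointwise hR hg
  have hV : Tendsto (fun j => (inner ℂ (V (weightOp (g j))) (weightOp (g j))).re) atTop (𝓝 v) :=
    (Complex.continuous_re.tendsto _).comp (((V.continuous.tendsto _).comp hW).inner hW)
  have hYsq : Tendsto (fun j => ‖dispersionOp κ (σ j) (g j)‖ ^ 2) atTop (𝓝 (v - L)) :=
    (hV.sub hF).congr fun j => sub_sub_cancel _ _
  have hY : Tendsto (fun j => ‖dispersionOp κ (σ j) (g j)‖) atTop (𝓝 √(v - L)) :=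
    hYsq.sqrt.congr fun j => Real.sqrt_sq (norm_nonneg _)
  have hpt : Tendsto (fun j => ((dispersionOp κ (σ j) (g j) : SeqSpace) : ℤ → ℂ)) atTop
      (𝓝 (dispersionOp κ σ₀ g₀ : SeqSpace)) :=
    tendsto_pi_nhds.mpr fun n => tendsto_dispersionOp_apply hσ (hg n)
  have hle : ‖dispersionOp κ σ₀ g₀‖ ≤ √(v - L) :=
    le_of_forall_gt_imp_ge_of_dense fun C hC =>
      lp.norm_le_of_tendsto (hY.eventually_le_const hC) hpt
  have hnonneg : 0 ≤ v - L := ge_of_tendsto' hYsq fun j => sq_nonneg _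
  have := pow_le_pow_left₀ (norm_nonneg _) hle 2
  rw [Real.sq_sqrt hnonneg] at this
  rw [rayleighForm]
  linarith

/-- The competitors in the variational problem for the largest eigenvalue of the family `B(σ)`: by
periodicity, the Bloch frequency `σ₁` may be confined to `[0, 1]`. -/
def normalizedPairs : Set ((ℝ × ℝ) × SeqSpace) :=
  {p | p.1.1 ∈ Icc (0 : ℝ) 1 ∧ ‖weightOp p.2‖ = 1}

theorem exists_isMaxOn_rayleighForm (hκ : 3 / 4 ≤ κ) {q : (ℝ × ℝ) × SeqSpace}
    (hq : q ∈ normalizedPairs) (hpos : 0 < rayleighForm κ V q.1 q.2) :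
    ∃ p ∈ normalizedPairs, IsMaxOn (fun p => rayleighForm κ V p.1 p.2) normalizedPairs p := by
  set F : (ℝ × ℝ) × SeqSpace → ℝ := fun p => rayleighForm κ V p.1 p.2
  have hbdd : BddAbove (F '' normalizedPairs) := by
    refine ⟨‖V‖, forall_mem_image.mpr fun p hp => ?_⟩
    have := rayleighForm_le (κ := κ) (V := V) (σ := p.1) (g := p.2)
    rw [hp.2] at this
    nlinarith [sq_nonneg ‖dispersionOp κ p.1 p.2‖]
  have hsup : 0 < sSup (F '' normalizedPairs) :=
    hpos.trans_le (le_csSup hbdd (mem_image_of_mem F hq))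
  obtain ⟨x, -, hx, hxmem⟩ := exists_seq_tendsto_sSup ⟨_, mem_image_of_mem F hq⟩ hbdd
  choose p hp hpx using hxmem
  obtain rfl : F ∘ p = x := funext hpx
  obtain ⟨N, hN⟩ := eventually_atTop.mp (hx.eventually_const_lt hsup)
  have hF : ∀ j, 0 ≤ F (p (j + N)) := fun j => (hN (j + N) (Nat.le_add_left N j)).le
  obtain ⟨σ₀, hσ₀, g₀, φ, hφ, hσ, hg⟩ := exists_subseq_tendsto_seq
    (K := Icc (0 : ℝ) 1 ×ˢ Icc (-(2 + ‖V‖)) (2 + ‖V‖)) (isCompact_Icc.prod isCompact_Icc)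
    (σ := fun j => (p (j + N)).1) (g := fun j => (p (j + N)).2)
    (fun j => ⟨(hp _).1, abs_le.mp
      (abs_snd_le_of_rayleighForm_nonneg (by linarith) (hF j) (hp _).2)⟩)
    (fun j => norm_le_of_rayleighForm_nonneg hκ (hp _).1 (hF j) (hp _).2)
  have hbound : ∀ j, ‖(p (φ j + N)).2‖ ≤ 72 * (1 + ‖V‖) :=
    fun j => norm_le_of_rayleighForm_nonneg hκ (hp _).1 (hF _) (hp _).2
  have hg₀ : ‖weightOp g₀‖ = 1 := by
    refine tendsto_nhds_unique (tendsto_weightOp_of_pointwise hbound hg).norm ?_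
    simp only [(hp _).2, tendsto_const_nhds]
  refine ⟨(σ₀, g₀), ⟨hσ₀.1, hg₀⟩, fun r hr => (le_csSup hbdd (mem_image_of_mem F hr)).trans ?_⟩
  exact le_rayleighForm_of_tendsto hσ hbound hg
    (hx.comp ((tendsto_add_atTop_nat N).comp hφ.tendsto_atTop))

theorem exists_normalized {f : SeqSpace} (hf : weightOp f ≠ 0) :
    ∃ f', ‖weightOp f'‖ = 1 ∧
      rayleighForm κ V σ f = rayleighForm κ V σ f' * ‖weightOp f‖ ^ 2 := by
  have hf' : ‖weightOp f‖ ≠ 0 := norm_ne_zero_iff.mpr hf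
  refine ⟨((‖weightOp f‖⁻¹ : ℝ) : ℂ) • f, ?_, ?_⟩
  · rw [map_smul, norm_smul, Complex.norm_real, norm_inv, norm_norm, inv_mul_cancel₀ hf']
  · rw [rayleighForm_smul]
    field_simp

theorem exists_maximizer (hκ : 3 / 4 ≤ κ) (hV : V.IsSymmetric) {θ : ℝ} (hθ : 0 < θ)
    (hσ : σ.1 ∈ Icc (0 : ℝ) 1) (hg : weightOp g ≠ 0)
    (hF : θ * ‖weightOp g‖ ^ 2 ≤ rayleighForm κ V σ g) :
    ∃ (lam : ℝ) (σ₀ : ℝ × ℝ) (g₀ : SeqSpace), θ ≤ lam ∧ ‖weightOp g₀‖ = 1 ∧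
      pencil κ V (σ₀, lam) g₀ = 0 ∧
      ∀ τ : ℝ × ℝ, τ.1 ∈ Icc (0 : ℝ) 1 → ∀ f, 0 ≤ (inner ℂ (pencil κ V (τ, lam) f) f).re := by
  obtain ⟨g₁, hg₁, hFg₁⟩ := exists_normalized (κ := κ) (V := V) (σ := σ) hg
  have hθg₁ : θ ≤ rayleighForm κ V σ g₁ :=
    le_of_mul_le_mul_right (hF.trans_eq hFg₁) (pow_pos (norm_pos_iff.mpr hg) 2)
  obtain ⟨⟨σ₀, g₀⟩, hp, hmax⟩ := exists_isMaxOn_rayleighForm (q := (σ, g₁)) hκ ⟨hσ, hg₁⟩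
    (hθ.trans_le hθg₁)
  set lam := rayleighForm κ V σ₀ g₀ with hlam
  have hnonneg : ∀ τ : ℝ × ℝ, τ.1 ∈ Icc (0 : ℝ) 1 → ∀ f,
      0 ≤ (inner ℂ (pencil κ V (τ, lam) f) f).re := by
    intro τ hτ f
    rw [re_inner_pencil, sub_nonneg]
    rcases eq_or_ne (weightOp f) 0 with hf | hf
    · have := rayleighForm_le (κ := κ) (V := V) (σ := τ) (g := f)
      rw [hf, norm_zero] at this ⊢
      nlinarith [sq_nonneg ‖dispersionOp κ τ f‖]
    · obtain ⟨f', hf', hFf'⟩ := exists_normalized (κ := κ) (V := V) (σ := τ) hf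
      rw [hFf']
      gcongr
      exact hmax (a := (τ, f')) ⟨hτ, hf'⟩
  refine ⟨lam, σ₀, g₀, hθg₁.trans (hmax (a := (σ, g₁)) ⟨hσ, hg₁⟩), hp.2, ?_, hnonneg⟩
  refine apply_eq_zero_of_isPositive ⟨isSymmetric_pencil hV _, hnonneg σ₀ hp.1⟩ ?_
  rw [re_inner_pencil, hp.2, ← hlam]
  ring

end Maximizer

end Pencil
section Multiplication

variable {φ ψ : C(Torus, ℂ)}

theorem coeFn_mulL2 (φ : C(Torus, ℂ)) (f : L2Torus) :
    mulL2 φ f =ᵐ[AddCircle.haarAddCircle] fun x => φ x * f x := by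
  have hsmul := Lp.coeFn_lpSMul (r := 2)
    (ContinuousMap.toLp ∞ AddCircle.haarAddCircle ℂ φ : Lp ℂ ∞ _) f
  have htoLp := ContinuousMap.coeFn_toLp (p := ∞) (𝕜 := ℂ) AddCircle.haarAddCircle φ
  refine hsmul.trans ?_
  filter_upwards [htoLp] with x hx
  rw [Pi.smul_apply', hx, smul_eq_mul]

theorem norm_mulL2_le (φ : C(Torus, ℂ)) (f : L2Torus) : ‖mulL2 φ f‖ ≤ ‖φ‖ * ‖f‖ := by
  refine (Lp.norm_smul_le (r := 2)
    (ContinuousMap.toLp ∞ AddCircle.haarAddCircle ℂ φ : Lp ℂ ∞ _) f).trans ?_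
  gcongr
  have h := ContinuousLinearMap.le_of_opNorm_le _
    (ContinuousMap.toLp_norm_le (p := ∞) (μ := AddCircle.haarAddCircle (T := 2 * π)) (E := ℂ)
      (𝕜 := ℂ)) φ
  simpa using h

theorem mulL2_add (φ ψ : C(Torus, ℂ)) (f : L2Torus) :
    mulL2 (φ + ψ) f = mulL2 φ f + mulL2 ψ f := by
  refine Lp.ext ?_
  filter_upwards [coeFn_mulL2 (φ + ψ) f, coeFn_mulL2 φ f, coeFn_mulL2 ψ f,
    Lp.coeFn_add (mulL2 φ f) (mulL2 ψ f)] with x hφψ hφ hψ hadd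
  rw [hφψ, hadd, Pi.add_apply, hφ, hψ, ContinuousMap.add_apply, add_mul]

theorem mulL2_smul (a : ℂ) (φ : C(Torus, ℂ)) (f : L2Torus) :
    mulL2 (a • φ) f = a • mulL2 φ f := by
  refine Lp.ext ?_
  filter_upwards [coeFn_mulL2 (a • φ) f, coeFn_mulL2 φ f, Lp.coeFn_smul a (mulL2 φ f)]
    with x haφ hφ hsmul
  rw [haφ, hsmul, Pi.smul_apply, hφ, ContinuousMap.smul_apply, smul_mul_assoc]

theorem mulL2_one (f : L2Torus) : mulL2 1 f = f := by
  refine Lp.ext ?_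
  filter_upwards [coeFn_mulL2 1 f] with x h
  rw [h, ContinuousMap.one_apply, one_mul]

theorem mulL2_mul (φ ψ : C(Torus, ℂ)) (f : L2Torus) :
    mulL2 (φ * ψ) f = mulL2 φ (mulL2 ψ f) := by
  refine Lp.ext ?_
  filter_upwards [coeFn_mulL2 (φ * ψ) f, coeFn_mulL2 φ (mulL2 ψ f), coeFn_mulL2 ψ f]
    with x hφψ hφ hψ
  rw [hφψ, hφ, hψ, ContinuousMap.mul_apply, mul_assoc]

theorem inner_mulL2_left (hφ : IsSelfAdjoint φ) (f g : L2Torus) :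
    inner ℂ (mulL2 φ f) g = inner ℂ f (mulL2 φ g) := by
  rw [L2.inner_def, L2.inner_def]
  refine integral_congr_ae ?_
  filter_upwards [coeFn_mulL2 φ f, coeFn_mulL2 φ g] with x hf hg
  have hφx : (starRingEnd ℂ) (φ x) = φ x := congrArg (fun χ : C(Torus, ℂ) => χ x) hφ
  rw [hf, hg]
  simp only [RCLike.inner_apply, map_mul, hφx]
  ring

theorem torusCoeff_mulL2_fourier (k : ℤ) (f : L2Torus) (n : ℤ) :
    torusCoeff (mulL2 (fourier k) f) n = torusCoeff f (n - k) := by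
  rw [torusCoeff, torusCoeff, fourierBasis_repr, fourierBasis_repr, fourierCoeff, fourierCoeff]
  refine integral_congr_ae ?_
  filter_upwards [coeFn_mulL2 (fourier k) f] with x hx
  rw [hx, show -(n - k) = -n + k by ring, fourier_add, smul_eq_mul, smul_eq_mul, mul_assoc]

/-- Multiplication by a continuous function, acting on Fourier coefficients. -/
noncomputable def multOp (φ : C(Torus, ℂ)) : SeqSpace →L[ℂ] SeqSpace :=
  fourierBasis.repr.toContinuousLinearEquiv.toContinuousLinearMap ∘L
    (mulL2 φ).mkContinuous ‖φ‖ (norm_mulL2_le φ) ∘L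
      fourierBasis.repr.symm.toContinuousLinearEquiv.toContinuousLinearMap

theorem multOp_apply (φ : C(Torus, ℂ)) (c : SeqSpace) :
    multOp φ c = fourierBasis.repr (mulL2 φ (fourierBasis.repr.symm c)) := rfl

theorem multOp_repr (φ : C(Torus, ℂ)) (f : L2Torus) :
    multOp φ (fourierBasis.repr f) = fourierBasis.repr (mulL2 φ f) := by
  rw [multOp_apply, LinearIsometryEquiv.symm_apply_apply]

theorem norm_multOp_le (φ : C(Torus, ℂ)) : ‖multOp φ‖ ≤ ‖φ‖ := by
  refine ContinuousLinearMap.opNorm_le_bound _ (norm_nonneg _) fun c => ?_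
  rw [multOp_apply, LinearIsometryEquiv.norm_map]
  exact (norm_mulL2_le _ _).trans_eq (by rw [LinearIsometryEquiv.norm_map])

theorem multOp_add (φ ψ : C(Torus, ℂ)) : multOp (φ + ψ) = multOp φ + multOp ψ :=
  ContinuousLinearMap.ext fun c => by
    simp only [multOp_apply, mulL2_add, map_add, _root_.add_apply]

theorem multOp_sub (φ ψ : C(Torus, ℂ)) : multOp (φ - ψ) = multOp φ - multOp ψ :=
  eq_sub_of_add_eq (by rw [← multOp_add, sub_add_cancel])

theorem multOp_smul (a : ℂ) (φ : C(Torus, ℂ)) : multOp (a • φ) = a • multOp φ :=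
  ContinuousLinearMap.ext fun c => by
    simp only [multOp_apply, mulL2_smul, map_smul, _root_.smul_apply]

theorem multOp_one : multOp 1 = 1 :=
  ContinuousLinearMap.ext fun c => by
    rw [multOp_apply, mulL2_one, LinearIsometryEquiv.apply_symm_apply, one_apply_eq_self]

theorem multOp_mul (φ ψ : C(Torus, ℂ)) : multOp (φ * ψ) = multOp φ * multOp ψ :=
  ContinuousLinearMap.ext fun c => by
    simp only [multOp_apply, mul_apply_eq_comp, mulL2_mul, LinearIsometryEquiv.symm_apply_apply]

theorem multOp_fourier_apply (k : ℤ) (c : SeqSpace) (n : ℤ) :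
    multOp (fourier k) c n = c (n - k) := by
  have h := torusCoeff_mulL2_fourier k (fourierBasis.repr.symm c) n
  rwa [torusCoeff, torusCoeff, LinearIsometryEquiv.apply_symm_apply] at h

theorem isSymmetric_multOp (hφ : IsSelfAdjoint φ) : (multOp φ).IsSymmetric := by
  intro f g
  have h := inner_mulL2_left hφ (fourierBasis.repr.symm f) (fourierBasis.repr.symm g)
  rwa [← fourierBasis.repr.inner_map_map, ← fourierBasis.repr.inner_map_map,
    LinearIsometryEquiv.apply_symm_apply, LinearIsometryEquiv.apply_symm_apply] at h

/-- Multiplication by `2 cos x`, acting on Fourier coefficients: it couples neighbouring modes. -/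
noncomputable def neighbourOp : SeqSpace →L[ℂ] SeqSpace := multOp (fourier 1 + fourier (-1))

theorem neighbourOp_apply (c : SeqSpace) (n : ℤ) : neighbourOp c n = c (n - 1) + c (n + 1) := by
  rw [neighbourOp, multOp_add]
  change multOp (fourier 1) c n + multOp (fourier (-1)) c n = _
  rw [multOp_fourier_apply, multOp_fourier_apply, sub_neg_eq_add]

theorem norm_neighbourOp_le : ‖neighbourOp‖ ≤ 2 := by
  refine (norm_multOp_le _).trans ((norm_add_le _ _).trans ?_)
  rw [fourier_norm, fourier_norm]
  norm_num

end Multiplication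
section Gap

variable {κ : ℝ} {σ : ℝ × ℝ}

theorem eq_of_abs_dispersion_lt (hκ : 3 / 4 ≤ κ) {n m : ℤ}
    (hnm : 0 ≤ ((n : ℝ) + σ.1) * (m + σ.1))
    (hn : |dispersion κ σ n| < 1 / 4) (hm : |dispersion κ σ m| < 1 / 4) : n = m := by
  by_contra hne
  have hdiff : (1 : ℝ) ≤ |((n : ℝ) + σ.1) - (m + σ.1)| := by
    rw [add_sub_add_right_eq_sub]
    exact_mod_cast Int.one_le_abs (sub_ne_zero.mpr hne)
  have hsum : |((n : ℝ) + σ.1) - (m + σ.1)| ≤ |((n : ℝ) + σ.1) + (m + σ.1)| :=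
    sq_le_sq.mp (by nlinarith)
  have hdisp : |dispersion κ σ m - dispersion κ σ n|
      = κ * (|((n : ℝ) + σ.1) + (m + σ.1)| * |((n : ℝ) + σ.1) - (m + σ.1)|) := by
    have hκ₀ : 0 < κ := by linarith
    rw [← abs_mul, ← abs_of_pos hκ₀, ← abs_mul, abs_of_pos hκ₀]
    congr 1
    simp only [dispersion]
    ring
  have hlt : |dispersion κ σ m - dispersion κ σ n| < 1 / 2 := by
    rw [abs_lt] at hn hm ⊢
    constructor <;> linarith
  nlinarith [one_le_mul_of_one_le_of_one_le (hdiff.trans hsum) hdiff]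

theorem exists_forall_ne_not {p q : ℤ → Prop} (hp : ∃ n, p n)
    (hpq : ∀ i j, p i → p j → q i → q j → i = j) : ∃ n, p n ∧ ∀ j, p j → j ≠ n → ¬ q j := by
  by_cases h : ∃ n, p n ∧ q n
  · obtain ⟨n, hpn, hqn⟩ := h
    exact ⟨n, hpn, fun j hpj hjn hqj => hjn (hpq j n hpj hpn hqj hqn)⟩
  · obtain ⟨n, hpn⟩ := hp
    exact ⟨n, hpn, fun j hpj _ hqj => h ⟨j, hpj, hqj⟩⟩

theorem exists_two_modes (hκ : 3 / 4 ≤ κ) (σ : ℝ × ℝ) :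
    ∃ n m : ℤ, n ≠ m ∧ ∀ j, j ≠ n → j ≠ m → 1 / 4 ≤ |dispersion κ σ j| := by
  obtain ⟨n, hn, hn'⟩ := exists_forall_ne_not (p := fun j : ℤ => 0 ≤ (j : ℝ) + σ.1)
    (q := fun j => |dispersion κ σ j| < 1 / 4) ⟨⌈-σ.1⌉, by linarith [Int.le_ceil (-σ.1)]⟩
    fun i j hi hj => eq_of_abs_dispersion_lt hκ (mul_nonneg hi hj)
  obtain ⟨m, hm, hm'⟩ := exists_forall_ne_not (p := fun j : ℤ => (j : ℝ) + σ.1 < 0)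
    (q := fun j => |dispersion κ σ j| < 1 / 4)
    ⟨⌈-σ.1⌉ - 1, by push_cast; linarith [Int.ceil_lt_add_one (-σ.1)]⟩
    fun i j hi hj => eq_of_abs_dispersion_lt hκ (mul_nonneg_of_nonpos_of_nonpos hi.le hj.le)
  refine ⟨n, m, ?_, fun j hjn hjm => not_lt.mp ?_⟩
  · rintro rfl
    exact hn.not_gt hm
  · exact (le_or_gt 0 ((j : ℝ) + σ.1)).elim (hn' j · hjn) (hm' j · hjm)

/-- The sequence supported on the modes `n` and `m`, with amplitudes `z` and `w`. -/
noncomputable def modePair (n m : ℤ) (z w : ℂ) : SeqSpace := lp.single 2 n z + lp.single 2 m w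

theorem modePair_apply (n m : ℤ) (z w : ℂ) (j : ℤ) :
    modePair n m z w j = (if j = n then z else 0) + if j = m then w else 0 := by
  change lp.single (E := fun _ : ℤ => ℂ) 2 n z j + lp.single (E := fun _ : ℤ => ℂ) 2 m w j = _
  simp only [lp.single_apply, Pi.single_apply]

theorem inner_modePair_left (n m : ℤ) (z w : ℂ) (x : SeqSpace) :
    inner ℂ (modePair n m z w) x = inner ℂ z (x n) + inner ℂ w (x m) := by
  rw [modePair, inner_add_left, lp.inner_single_left, lp.inner_single_left]

theorem inner_modePair_right (n m : ℤ) (z w : ℂ) (x : SeqSpace) :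
    inner ℂ x (modePair n m z w) = inner ℂ (x n) z + inner ℂ (x m) w := by
  rw [modePair, inner_add_right, lp.inner_single_right, lp.inner_single_right]

theorem norm_sq_modePair {n m : ℤ} (hnm : n ≠ m) (z w : ℂ) :
    ‖modePair n m z w‖ ^ 2 = ‖z‖ ^ 2 + ‖w‖ ^ 2 := by
  have h : inner ℂ (modePair n m z w) (modePair n m z w) = inner ℂ z z + inner ℂ w w := by
    rw [inner_modePair_right]
    simp only [modePair_apply, hnm, hnm.symm, if_true, if_false, add_zero, zero_add]
  simp only [inner_self_eq_ofReal_norm_sq] at h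
  exact_mod_cast h

theorem re_inner_neighbourOp_modePair {n m : ℤ} (hnm : n ≠ m) (z w : ℂ) :
    (inner ℂ (neighbourOp (modePair n m z w)) (modePair n m z w)).re
      = if |n - m| = 1 then 2 * (inner ℂ z w).re else 0 := by
  rw [inner_modePair_right, neighbourOp_apply, neighbourOp_apply]
  simp only [modePair_apply]
  by_cases h : |n - m| = 1
  · rw [if_pos h, two_mul]
    nth_rewrite 2 [← Complex.conj_re]
    rw [inner_conj_symm, ← Complex.add_re]
    rcases (abs_eq zero_le_one).mp h with h' | h'
    · obtain rfl : n = m + 1 := by omega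
      have hm : m + 1 + 1 ≠ m ∧ m - 1 ≠ m + 1 := by omega
      simp [hm]
    · obtain rfl : m = n + 1 := by omega
      have hn : n + 1 + 1 ≠ n ∧ n - 1 ≠ n + 1 := by omega
      simp [hn]
  · rw [if_neg h]
    have h1 : ¬ n - 1 = m ∧ ¬ n + 1 = m ∧ ¬ m - 1 = n ∧ ¬ m + 1 = n := by grind
    simp [h1]

theorem mul_re_inner_neighbourOp_modePair_nonpos {n m : ℤ} (hnm : n ≠ m) {s t : ℝ}
    (hst : s * t = |t|) {z w : ℂ} (hzw : z + s * w = 0) :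
    t * (inner ℂ (neighbourOp (modePair n m z w)) (modePair n m z w)).re ≤ 0 := by
  have hre : t * (inner ℂ z w).re = -(|t| * ‖w‖ ^ 2) := by
    rw [eq_neg_of_add_eq_zero_left hzw, ← smul_eq_mul (s : ℂ), inner_neg_left, inner_smul_left,
      Complex.conj_ofReal, inner_self_eq_ofReal_norm_sq, Complex.neg_re, Complex.re_ofReal_mul,
      Complex.ofReal_re, ← hst]
    ring
  rw [re_inner_neighbourOp_modePair hnm, mul_ite, mul_zero]
  split_ifs
  · rw [mul_left_comm, hre]
    nlinarith [mul_nonneg (abs_nonneg t) (sq_nonneg ‖w‖)]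
  · exact le_rfl

theorem mul_re_inner_neighbourOp_add_le (t : ℝ) (x y : SeqSpace) :
    t * (inner ℂ (neighbourOp (x + y)) (x + y)).re
      ≤ t * (inner ℂ (neighbourOp x) x).re + |t| * (4 * (‖x‖ * ‖y‖)) + |t| * (2 * ‖y‖ ^ 2) := by
  have hA : ‖(t : ℂ) • neighbourOp‖ ≤ |t| * 2 := by
    rw [norm_smul, Complex.norm_real, Real.norm_eq_abs]
    gcongr
    exact norm_neighbourOp_le
  have h := re_inner_map_add_self_le ((t : ℂ) • neighbourOp) x y
  simp only [_root_.smul_apply, inner_smul_left, Complex.conj_ofReal, Complex.re_ofReal_mul] at h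
  have hxy := mul_le_mul_of_nonneg_right hA (mul_nonneg (norm_nonneg x) (norm_nonneg y))
  have hyy := mul_le_mul_of_nonneg_right hA (sq_nonneg ‖y‖)
  linarith

theorem weightOp_modePair (n m : ℤ) (z w : ℂ) :
    weightOp (modePair n m z w)
      = modePair n m (((1 + (n : ℝ) ^ 2)⁻¹ : ℝ) * z) (((1 + (m : ℝ) ^ 2)⁻¹ : ℝ) * w) := by
  ext j
  rw [weightOp_apply, modePair_apply, modePair_apply, mul_add, mul_ite, mul_ite, mul_zero]
  congr 1 <;> split_ifs with h <;> simp only [h]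

theorem dispersionOp_modePair_eq_zero {n m : ℤ} (hn : dispersion κ σ n = 0)
    (hm : dispersion κ σ m = 0) (z w : ℂ) : dispersionOp κ σ (modePair n m z w) = 0 := by
  ext j
  rw [dispersionOp_apply, weightOp_apply, modePair_apply]
  split_ifs with hjn hjm hjm <;> simp_all

section Perturbation

variable {e t : ℝ} {V : SeqSpace →L[ℂ] SeqSpace}

theorem abs_re_inner_sub_le (e t : ℝ) (V : SeqSpace →L[ℂ] SeqSpace) (c : SeqSpace) :
    |(inner ℂ (V c) c).re - (e * ‖c‖ ^ 2 + t * (inner ℂ (neighbourOp c) c).re)|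
      ≤ ‖V - (e : ℂ) • 1 - (t : ℂ) • neighbourOp‖ * ‖c‖ ^ 2 := by
  have h := abs_re_inner_map_le (V - (e : ℂ) • 1 - (t : ℂ) • neighbourOp) c c
  simp only [_root_.sub_apply, _root_.smul_apply, one_apply_eq_self, inner_sub_left,
    inner_smul_left, Complex.conj_ofReal, Complex.sub_re, Complex.re_ofReal_mul,
    inner_self_eq_ofReal_norm_sq, Complex.ofReal_re] at h
  rwa [mul_assoc, ← sq, sub_sub] at h

/-- The modes outside of the resonant pair cost a definite amount of dispersion, and on the pair
the constraint makes the coupling favourable. -/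
theorem rayleighForm_le_of_two_modes {n m : ℤ} (hnm : n ≠ m)
    (hdisp : ∀ j, j ≠ n → j ≠ m → 1 / 4 ≤ |dispersion κ σ j|) (ht : 64 * |t| ≤ 1) {s : ℝ}
    (hst : s * t = |t|) {g : SeqSpace} (hg : inner ℂ (modePair n m 1 s) (weightOp g) = 0) :
    rayleighForm κ V σ g
      ≤ (e + ‖V - (e : ℂ) • 1 - (t : ℂ) • neighbourOp‖ + 128 * t ^ 2) * ‖weightOp g‖ ^ 2 := by
  set c := weightOp g
  set P := modePair n m (c n) (c m)
  set Q := c - P with hQ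
  have hQ_apply : ∀ j, Q j = if j = n ∨ j = m then 0 else c j := by
    intro j
    change c j - modePair n m (c n) (c m) j = _
    rw [modePair_apply]
    grind
  have hnorm : ‖c‖ ^ 2 = ‖P‖ ^ 2 + ‖Q‖ ^ 2 := by
    rw [← norm_add_sq_of_inner_eq_zero, hQ, add_sub_cancel]
    rw [inner_modePair_left, hQ_apply, hQ_apply]
    simp
  have hQY : ‖Q‖ ^ 2 ≤ 16 * ‖dispersionOp κ σ g‖ ^ 2 := by
    refine norm_sq_le_mul_of_forall_le fun j => ?_
    rw [norm_dispersionOp_apply, hQ_apply]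
    split_ifs with hj
    · rw [norm_zero, zero_pow two_ne_zero]
      positivity
    · rw [not_or] at hj
      nlinarith [pow_le_pow_left₀ (by norm_num) (hdisp j hj.1 hj.2) 2, sq_nonneg ‖c j‖]
  have hcoupling : t * (inner ℂ (neighbourOp c) c).re
      ≤ |t| * (4 * (‖P‖ * ‖Q‖)) + |t| * (2 * ‖Q‖ ^ 2) := by
    have hcnm : c n + s * c m = 0 := by
      rw [inner_modePair_left] at hg
      simpa [mul_comm] using hg
    have hP_nonpos := mul_re_inner_neighbourOp_modePair_nonpos hnm hst hcnm
    have hPQ := mul_re_inner_neighbourOp_add_le t P Q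
    rw [hQ, add_sub_cancel, ← hQ] at hPQ
    linarith
  have hV := (abs_le.mp (abs_re_inner_sub_le e t V c)).2
  have hPQ : |t| * (4 * (‖P‖ * ‖Q‖)) ≤ 1 / 32 * ‖Q‖ ^ 2 + 128 * t ^ 2 * ‖P‖ ^ 2 := by
    rw [← sq_abs t]
    nlinarith [sq_nonneg (‖Q‖ - 64 * (|t| * ‖P‖))]
  have hQQ : |t| * (2 * ‖Q‖ ^ 2) ≤ 1 / 32 * ‖Q‖ ^ 2 := by nlinarith [sq_nonneg ‖Q‖]
  rw [rayleighForm]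
  nlinarith [mul_nonneg (sq_nonneg t) (sq_nonneg ‖Q‖)]

theorem exists_resonant_test (hκ : κ ≤ 4) {s : ℝ} (hs : s ^ 2 = 1) (hst : s * t = |t|) :
    ∃ σ : ℝ × ℝ, σ.1 ∈ Icc (0 : ℝ) 1 ∧ ∃ g : SeqSpace, weightOp g ≠ 0 ∧
      (e + |t| - ‖V - (e : ℂ) • 1 - (t : ℂ) • neighbourOp‖) * ‖weightOp g‖ ^ 2
        ≤ rayleighForm κ V σ g := by
  set σ : ℝ × ℝ := (1 / 2, √(1 - κ / 4)) with hσ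
  have hdisp : dispersion κ σ 0 = 0 ∧ dispersion κ σ (-1) = 0 := by
    have hsq : √(1 - κ / 4) ^ 2 = 1 - κ / 4 := Real.sq_sqrt (by linarith)
    simp only [hσ, dispersion, hsq]
    push_cast
    constructor <;> ring
  set g := modePair 0 (-1) 1 (2 * s) with hg
  have hgc : weightOp g = modePair 0 (-1) 1 s := by
    rw [hg, weightOp_modePair]
    push_cast
    congr 1 <;> ring
  have hnorm : ‖weightOp g‖ ^ 2 = 2 := by
    rw [hgc, norm_sq_modePair (by decide), Complex.norm_real, Real.norm_eq_abs, sq_abs, hs,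
      norm_one]
    norm_num
  have hform : (inner ℂ (neighbourOp (weightOp g)) (weightOp g)).re = 2 * s := by
    rw [hgc, re_inner_neighbourOp_modePair (by decide)]
    simp
  refine ⟨σ, by norm_num [hσ], g, ?_, ?_⟩
  · rintro h
    norm_num [h] at hnorm
  · have := (abs_le.mp (abs_re_inner_sub_le e t V (weightOp g))).1
    rw [rayleighForm, dispersionOp_modePair_eq_zero hdisp.1 hdisp.2, norm_zero]
    rw [hform, hnorm] at this
    rw [hnorm]
    linarith

end Perturbation

end Gap
section Branch

variable {κ : ℝ} {σ : ℝ × ℝ} {μ : ℝ} {V : SeqSpace →L[ℂ] SeqSpace}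

/-- The property that `V - diag (dispersion²)` has the eigenvalue `μ`: there is a nonzero sequence
solving the eigenvalue equation, whose decay is a consequence. -/
def HasEigensequence (κ : ℝ) (V : SeqSpace →L[ℂ] SeqSpace) (σ : ℝ × ℝ) (μ : ℝ) : Prop :=
  ∃ c : SeqSpace, c ≠ 0 ∧ ∀ n, (μ : ℂ) * c n + (dispersion κ σ n : ℂ) ^ 2 * c n = V c n

/-- For a family of sets of eigenvalues `{μ | E σ μ}`: a largest eigenvalue exists, and it continues
analytically in `σ`. -/
def HasMaximalAnalyticBranch (E : ℝ × ℝ → ℝ → Prop) : Prop :=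
  ∃ (lamM : ℝ) (σbar : ℝ × ℝ), E σbar lamM ∧ (∀ σ μ, E σ μ → μ ≤ lamM) ∧
    ∃ (N : Set (ℝ × ℝ)) (lam : ℝ × ℝ → ℝ), IsOpen N ∧ σbar ∈ N ∧ AnalyticOnNhd ℝ lam N ∧
      lam σbar = lamM ∧ ∀ σ ∈ N, E σ (lam σ)

theorem memℓp_of_eigensequence (hκ : 3 / 4 ≤ κ) {c : SeqSpace}
    (hc : ∀ n, (μ : ℂ) * c n + (dispersion κ σ n : ℂ) ^ 2 * c n = V c n) :
    Memℓp (fun n : ℤ => ((1 + (n : ℝ) ^ 2) ^ 2 : ℝ) • c n) 2 := by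
  set K := 4 + 2 * σ.1 ^ 2
  have hmem : Memℓp (fun n => (2 * K ^ 2) * (‖c n‖ + ‖(V c - (μ : ℂ) • c) n‖) : ℤ → ℝ) 2 :=
    Memℓp.const_mul ((memℓp_norm_iff.mpr (lp.memℓp c)).add
      (memℓp_norm_iff.mpr (lp.memℓp (V c - (μ : ℂ) • c)))) _
  refine hmem.mono' (F := fun _ => ℝ) fun n => ?_
  have hdisp : ‖(V c - (μ : ℂ) • c) n‖ = |dispersion κ σ n| ^ 2 * ‖c n‖ := by
    have : (V c - (μ : ℂ) • c) n = (dispersion κ σ n : ℂ) ^ 2 * c n :=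
      sub_eq_of_eq_add' (hc n).symm
    rw [this, norm_mul, norm_pow, Complex.norm_real, Real.norm_eq_abs]
  have hweight : (1 + (n : ℝ) ^ 2) ^ 2 ≤ 2 * K ^ 2 * (1 + |dispersion κ σ n| ^ 2) :=
    calc (1 + (n : ℝ) ^ 2) ^ 2 ≤ (K * (1 + |dispersion κ σ n|)) ^ 2 := by
          gcongr
          exact one_add_sq_le_dispersion hκ σ n
      _ ≤ K ^ 2 * (2 * (1 ^ 2 + |dispersion κ σ n| ^ 2)) := by
          rw [mul_pow]
          gcongr
          exact add_sq_le
      _ = _ := by ring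
  rw [hdisp, norm_smul, Real.norm_of_nonneg (by positivity), Real.norm_of_nonneg (by positivity)]
  calc (1 + (n : ℝ) ^ 2) ^ 2 * ‖c n‖ ≤ 2 * K ^ 2 * (1 + |dispersion κ σ n| ^ 2) * ‖c n‖ := by gcongr
    _ = _ := by ring

theorem pencil_apply_apply (g : SeqSpace) (n : ℤ) :
    pencil κ V (σ, μ) g n = (((1 + (n : ℝ) ^ 2)⁻¹ : ℝ) : ℂ) * ((μ : ℂ) * weightOp g n
      + (dispersion κ σ n : ℂ) ^ 2 * weightOp g n - V (weightOp g) n) := by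
  have : pencil κ V (σ, μ) g n = (μ : ℂ) * weightOp (weightOp g) n
    + dispersionOp κ σ (dispersionOp κ σ g) n - weightOp (V (weightOp g)) n := rfl
  rw [this]
  simp only [dispersionOp_apply, weightOp_apply]
  ring

theorem pencil_eq_zero_iff {g : SeqSpace} : pencil κ V (σ, μ) g = 0 ↔
    ∀ n, (μ : ℂ) * weightOp g n + (dispersion κ σ n : ℂ) ^ 2 * weightOp g n = V (weightOp g) n := by
  have hw : ∀ n : ℤ, (((1 + (n : ℝ) ^ 2)⁻¹ : ℝ) : ℂ) ≠ 0 := fun n => by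
    exact_mod_cast (inv_pos.mpr (one_add_sq_pos n)).ne'
  rw [lp.ext_iff, funext_iff]
  refine forall_congr' fun n => ?_
  rw [pencil_apply_apply]
  exact (mul_eq_zero_iff_left (hw n)).trans sub_eq_zero

theorem exists_weightOp_eq_of_memℓp {c : SeqSpace}
    (hc : Memℓp (fun n : ℤ => ((1 + (n : ℝ) ^ 2) ^ 2 : ℝ) • c n) 2) : ∃ g, weightOp g = c := by
  have hmem : Memℓp (fun n : ℤ => ((1 + (n : ℝ) ^ 2 : ℝ) : ℂ) * c n) 2 := by
    refine hc.mono' fun n => ?_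
    rw [norm_mul, norm_smul, Complex.norm_real, norm_pow]
    refine mul_le_mul_of_nonneg_right ?_ (norm_nonneg _)
    rw [Real.norm_of_nonneg (one_add_sq_pos n).le]
    exact le_self_pow₀ (le_add_of_nonneg_right (sq_nonneg _)) two_ne_zero
  refine ⟨⟨_, hmem⟩, ?_⟩
  ext n
  rw [weightOp_apply, ← mul_assoc, ← Complex.ofReal_mul, inv_mul_cancel₀ (one_add_sq_pos n).ne',
    Complex.ofReal_one, one_mul]

theorem hasEigensequence_iff (hκ : 3 / 4 ≤ κ) :
    HasEigensequence κ V σ μ ↔ ∃ g, g ≠ 0 ∧ pencil κ V (σ, μ) g = 0 := by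
  constructor
  · rintro ⟨c, hc, hcn⟩
    obtain ⟨g, rfl⟩ := exists_weightOp_eq_of_memℓp (memℓp_of_eigensequence hκ hcn)
    exact ⟨g, fun hg => hc (by rw [hg, map_zero]), pencil_eq_zero_iff.mpr hcn⟩
  · rintro ⟨g, hg, hgμ⟩
    exact ⟨weightOp g, (map_ne_zero_iff _ weightOp_injective).mpr hg, pencil_eq_zero_iff.mp hgμ⟩

theorem HasEigensequence.shift {φ : C(Torus, ℂ)} (h : HasEigensequence κ (multOp φ) σ μ) (k : ℤ) :
    HasEigensequence κ (multOp φ) (σ.1 - k, σ.2) μ := by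
  obtain ⟨c, hc, hcn⟩ := h
  refine ⟨multOp (fourier k) c, fun h0 => hc ?_, fun n => ?_⟩
  · ext n
    have := congrArg (fun x : SeqSpace => x (n + k)) h0
    simpa [multOp_fourier_apply] using this
  · have hcomm : multOp φ (multOp (fourier k) c) = multOp (fourier k) (multOp φ c) := by
      rw [← mul_apply_eq_comp, ← mul_apply_eq_comp, ← multOp_mul, ← multOp_mul, mul_comm]
    have hdisp : dispersion κ (σ.1 - k, σ.2) n = dispersion κ σ (n - k) := by
      simp only [dispersion]
      push_cast
      ring
    rw [hcomm, multOp_fourier_apply, multOp_fourier_apply, hdisp, hcn (n - k)]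

theorem isUnit_pencil_add_rankOne (hκ : 3 / 4 ≤ κ) (hV : V.IsSymmetric) {lam γ : ℝ}
    (hlam : 0 ≤ lam) {g₀ : SeqSpace} (hg₀ : ‖weightOp g₀‖ = 1)
    (hker : pencil κ V (σ, lam) g₀ = 0) (hγ : 0 < γ) (ℓ : SeqSpace →ₗ[ℂ] ℂ)
    (hgap : ∀ g, ℓ g = 0 →
      γ * ‖weightOp g‖ ^ 2 ≤ (inner ℂ (pencil κ V (σ, lam) g) g).re) :
    IsUnit (pencil κ V (σ, lam)
      + InnerProductSpace.rankOne ℂ (weightOp (weightOp g₀)) (weightOp (weightOp g₀))) := by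
  have hA := isSymmetric_pencil (κ := κ) hV (σ, lam)
  have hWg₀ : weightOp g₀ ≠ 0 := norm_ne_zero_iff.mp (hg₀ ▸ one_ne_zero)
  exact isUnit_add_rankOne hA isSymmetric_weightOp hker hg₀ hγ
    (fun g hg => gap_on_orthogonal_of_gap_on_ker hA isSymmetric_weightOp hker hWg₀ hγ ℓ hgap hg)
    (by positivity) (by positivity) fun g => norm_sq_le_pencil hκ hlam

theorem exists_analyticAt_eigenvalue (hκ : 3 / 4 ≤ κ) (hV : V.IsSymmetric) {lam₀ : ℝ}
    {g₀ : SeqSpace} (hg₀ : ‖weightOp g₀‖ = 1) (hker : pencil κ V (σ, lam₀) g₀ = 0)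
    (hu : IsUnit (pencil κ V (σ, lam₀)
      + InnerProductSpace.rankOne ℂ (weightOp (weightOp g₀)) (weightOp (weightOp g₀)))) :
    ∃ lam : ℝ × ℝ → ℝ, AnalyticAt ℝ lam σ ∧ lam σ = lam₀ ∧
      ∀ᶠ τ in 𝓝 σ, HasEigensequence κ V τ (lam τ) := by
  have hkg₀ : inner ℂ (weightOp (weightOp g₀)) g₀ = 1 := by
    rw [inner_map_left isSymmetric_weightOp, inner_self_eq_ofReal_norm_sq, hg₀]
    norm_num
  have hline : ∀ μ : ℝ, pencil κ V (σ, μ) g₀ = ((μ - lam₀ : ℝ) : ℂ) • weightOp (weightOp g₀) := by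
    intro μ
    rw [← sub_zero (pencil κ V (σ, μ) g₀), ← hker, pencil_apply, pencil_apply]
    push_cast
    module
  obtain ⟨lam, hlam, hlam₀, hev⟩ := exists_analyticAt_kernel (analyticAt_pencil _)
    (isSymmetric_pencil hV) hkg₀ hline hu
  exact ⟨lam, hlam, hlam₀, hev.mono fun τ hτ => (hasEigensequence_iff hκ).mpr hτ⟩

theorem le_of_hasEigensequence (hκ : 3 / 4 ≤ κ) {lam : ℝ}
    (hnonneg : ∀ g, 0 ≤ (inner ℂ (pencil κ V (σ, lam) g) g).re)
    (hμ : HasEigensequence κ V σ μ) : μ ≤ lam := by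
  obtain ⟨g, hg, hgμ⟩ := (hasEigensequence_iff hκ).mp hμ
  have hWg : 0 < ‖weightOp g‖ := norm_pos_iff.mpr ((map_ne_zero_iff _ weightOp_injective).mpr hg)
  have hμform := re_inner_pencil (κ := κ) (V := V) σ μ g
  have hlamform := hnonneg g
  rw [hgμ, inner_zero_left, Complex.zero_re] at hμform
  rw [re_inner_pencil] at hlamform
  exact le_of_mul_le_mul_right (by linarith) (pow_pos hWg 2)

theorem exists_simple_top_eigenvalue (hκ : 3 / 4 ≤ κ) (hκ' : κ ≤ 4) (hV : V.IsSymmetric) {e t : ℝ}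
    (he : 0 ≤ e) (hsmall : 2 * ‖V - (e : ℂ) • 1 - (t : ℂ) • neighbourOp‖ + 128 * t ^ 2 < |t|) :
    ∃ (lam₀ : ℝ) (σ₀ : ℝ × ℝ) (g₀ : SeqSpace), 0 < lam₀ ∧ ‖weightOp g₀‖ = 1 ∧
      pencil κ V (σ₀, lam₀) g₀ = 0 ∧
      (∀ τ : ℝ × ℝ, τ.1 ∈ Icc (0 : ℝ) 1 → ∀ f, 0 ≤ (inner ℂ (pencil κ V (τ, lam₀) f) f).re) ∧
      IsUnit (pencil κ V (σ₀, lam₀)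
        + InnerProductSpace.rankOne ℂ (weightOp (weightOp g₀)) (weightOp (weightOp g₀))) := by
  set δ := ‖V - (e : ℂ) • 1 - (t : ℂ) • neighbourOp‖
  have hδ : 0 ≤ δ := norm_nonneg _
  have ht : 64 * |t| ≤ 1 := by
    rw [← sq_abs t] at hsmall
    nlinarith [abs_nonneg t]
  obtain ⟨s, hs, hst⟩ : ∃ s : ℝ, s ^ 2 = 1 ∧ s * t = |t| := by
    rcases abs_choice t with h | h
    exacts [⟨1, by norm_num, by rw [h, one_mul]⟩, ⟨-1, by norm_num, by rw [h, neg_one_mul]⟩]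
  obtain ⟨σ, hσ, g, hg, hform⟩ := exists_resonant_test (V := V) (e := e) hκ' hs hst
  have hθ : 0 < e + |t| - δ := by nlinarith [sq_nonneg t]
  obtain ⟨lam₀, σ₀, g₀, hlam₀, hg₀, hker, hmax⟩ := exists_maximizer hκ hV hθ hσ hg hform
  obtain ⟨n, m, hnm, hdisp⟩ := exists_two_modes hκ σ₀
  refine ⟨lam₀, σ₀, g₀, hθ.trans_le hlam₀, hg₀, hker, hmax, ?_⟩
  refine isUnit_pencil_add_rankOne hκ hV (hθ.trans_le hlam₀).le hg₀ hker
    (γ := lam₀ - (e + δ + 128 * t ^ 2)) (by linarith)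
    (innerSL ℂ (modePair n m 1 s) ∘L weightOp).toLinearMap fun f hf => ?_
  rw [re_inner_pencil, sub_mul]
  exact sub_le_sub_left (rayleighForm_le_of_two_modes hnm hdisp ht hst hf) _

theorem hasMaximalAnalyticBranch_multOp (hκ : 3 / 4 ≤ κ) (hκ' : κ ≤ 4) {φ : C(Torus, ℂ)}
    (hφ : IsSelfAdjoint φ) {e t : ℝ} (he : 0 ≤ e)
    (hsmall : 2 * ‖multOp φ - (e : ℂ) • 1 - (t : ℂ) • neighbourOp‖ + 128 * t ^ 2 < |t|) :
    HasMaximalAnalyticBranch fun σ μ => 0 < μ ∧ HasEigensequence κ (multOp φ) σ μ := by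
  obtain ⟨lam₀, σ₀, g₀, hpos, hg₀, hker, hmax, hu⟩ :=
    exists_simple_top_eigenvalue hκ hκ' (isSymmetric_multOp hφ) he hsmall
  obtain ⟨lam, hlam, hlam₀, hev⟩ :=
    exists_analyticAt_eigenvalue hκ (isSymmetric_multOp hφ) hg₀ hker hu
  obtain ⟨N, hN, hNo, hσN⟩ := eventually_nhds_iff.mp <| hlam.eventually_analyticAt.and <|
    (hlam.continuousAt.eventually_const_lt (hlam₀.symm ▸ hpos)).and hev
  refine ⟨lam₀, σ₀, hlam₀ ▸ (hN σ₀ hσN).2, fun σ μ hμ => ?_, N, lam, hNo, hσN,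
    fun σ hσ => (hN σ hσ).1, hlam₀, fun σ hσ => (hN σ hσ).2⟩
  refine le_of_hasEigensequence hκ (hmax (σ.1 - ⌊σ.1⌋, σ.2) ?_) (hμ.2.shift ⌊σ.1⌋)
  exact ⟨Int.fract_nonneg σ.1, (Int.fract_lt_one σ.1).le⟩

section BlochOperator

variable {b s ε ω : ℝ} {u : C(Torus, ℝ)}

theorem blochSymbol_eq (ε ω : ℝ) (σ : ℝ × ℝ) (n : ℤ) :
    blochSymbol ε ω σ n = -(dispersion (1 + 2 * ε * ω) σ n : ℂ) ^ 2 := by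
  have h : (Complex.I * n + Complex.I * σ.1) ^ 2 = -((n : ℂ) + σ.1) ^ 2 := by
    rw [← mul_add, mul_pow, Complex.I_sq, neg_one_mul]
  rw [blochSymbol, h, dispersion]
  push_cast
  ring

theorem torusCoeff_blochOperator (W : (blochOperator b s ε ω u σ).domain) (n : ℤ) :
    torusCoeff (blochOperator b s ε ω u σ W) n
      = multOp (rollPotential b s ε u) (fourierBasis.repr (W : L2Torus)) n
        - (dispersion (1 + 2 * ε * ω) σ n : ℂ) ^ 2 * torusCoeff W n := by
  have hsplit : blochOperator b s ε ω u σ W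
      = blochPrincipal ε ω σ W + mulL2 (rollPotential b s ε u) (W : L2Torus) := rfl
  have hprincipal : torusCoeff (blochPrincipal ε ω σ W) n
      = blochSymbol ε ω σ n * torusCoeff W n := by
    change fourierBasis.repr (fourierBasis.repr.symm _) n = _
    rw [LinearIsometryEquiv.apply_symm_apply]
  rw [sub_eq_neg_add, ← neg_mul, ← blochSymbol_eq, ← hprincipal, multOp_repr, hsplit, torusCoeff,
    map_add]
  rfl

theorem blochOperator_apply_eq_smul_iff (W : (blochOperator b s ε ω u σ).domain) :
    blochOperator b s ε ω u σ W = (μ : ℂ) • (W : L2Torus) ↔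
      ∀ n, (μ : ℂ) * torusCoeff W n + (dispersion (1 + 2 * ε * ω) σ n : ℂ) ^ 2 * torusCoeff W n
        = multOp (rollPotential b s ε u) (fourierBasis.repr (W : L2Torus)) n := by
  rw [← fourierBasis.repr.injective.eq_iff, lp.ext_iff, funext_iff, map_smul]
  refine forall_congr' fun n => ?_
  change torusCoeff _ n = (μ : ℂ) * torusCoeff W n ↔ _
  rw [torusCoeff_blochOperator, sub_eq_iff_eq_add, eq_comm]

theorem isUnstableEigenvalue_iff (hκ : 3 / 4 ≤ 1 + 2 * ε * ω) :
    IsUnstableEigenvalue (blochOperator b s ε ω u σ) μ ↔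
      0 < μ ∧ HasEigensequence (1 + 2 * ε * ω) (multOp (rollPotential b s ε u)) σ μ := by
  refine and_congr_right fun _ => ⟨?_, ?_⟩
  · rintro ⟨W, hW, hWμ⟩
    exact ⟨fourierBasis.repr (W : L2Torus), (map_ne_zero_iff _ fourierBasis.repr.injective).mpr hW,
      (blochOperator_apply_eq_smul_iff W).mp hWμ⟩
  · rintro ⟨c, hc, hcn⟩
    obtain ⟨f, rfl⟩ := (fourierBasis (T := 2 * π)).repr.surjective c
    exact ⟨⟨f, memℓp_of_eigensequence hκ hcn⟩,
      fun hf => hc ((map_eq_zero_iff _ fourierBasis.repr.injective).mpr hf),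
      (blochOperator_apply_eq_smul_iff _).mpr hcn⟩

theorem hasMaximalAnalyticBranch_blochOperator (hκ : 3 / 4 ≤ 1 + 2 * ε * ω)
    (hκ' : 1 + 2 * ε * ω ≤ 4) {t : ℝ}
    (hsmall : 2 * ‖rollPotential b s ε u - ((ε ^ 2 : ℝ) : ℂ) • 1
      - (t : ℂ) • (fourier 1 + fourier (-1) : C(Torus, ℂ))‖ + 128 * t ^ 2 < |t|) :
    HasMaximalAnalyticBranch fun σ => IsUnstableEigenvalue (blochOperator b s ε ω u σ) := by
  have hreal : IsSelfAdjoint (rollPotential b s ε u) :=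
    ContinuousMap.ext fun x => Complex.conj_ofReal _
  simp only [funext fun σ => funext fun μ => propext (isUnstableEigenvalue_iff (b := b) (s := s)
    (u := u) (σ := σ) (μ := μ) hκ)]
  refine hasMaximalAnalyticBranch_multOp hκ hκ' hreal (sq_nonneg ε) (t := t)
    (lt_of_le_of_lt ?_ hsmall)
  gcongr
  refine le_of_eq_of_le (congrArg norm ?_) (norm_multOp_le _)
  rw [multOp_sub, multOp_sub, multOp_smul, multOp_smul, multOp_one, neighbourOp, multOp_add]

end BlochOperator

end Branch

section CosineSeries

/-- The function `x ↦ cos (n x)` on the torus. -/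
noncomputable def cosFun (n : ℤ) : C(Torus, ℝ) := ⟨fun x => (fourier n x).re, by fun_prop⟩

@[simp]
theorem cosFun_coe (n : ℤ) (x : ℝ) : cosFun n (x : Torus) = Real.cos (n * x) := by
  have harg : 2 * (π : ℂ) * Complex.I * n * x / ((2 * π : ℝ) : ℂ)
      = ((n * x : ℝ) : ℂ) * Complex.I := by
    have : (π : ℂ) ≠ 0 := by exact_mod_cast Real.pi_ne_zero
    push_cast
    field_simp
  change (fourier n (x : Torus)).re = _
  rw [fourier_coe_apply, harg, Complex.exp_ofReal_mul_I_re]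

theorem ofReal_cosFun (n : ℤ) (x : Torus) :
    (cosFun n x : ℂ) = (fourier n x + fourier (-n) x) / 2 := by
  rw [fourier_neg, Complex.add_conj]
  change (((fourier n x).re : ℝ) : ℂ) = _
  push_cast
  ring

theorem cosFun_neg (n : ℤ) : cosFun (-n) = cosFun n := by
  ext x
  induction x using QuotientAddGroup.induction_on with
  | H x => rw [cosFun_coe, cosFun_coe, Int.cast_neg, neg_mul, Real.cos_neg]

theorem even_cosFun (n : ℤ) : Function.Even (cosFun n) := by
  intro x
  induction x using QuotientAddGroup.induction_on with
  | H x => rw [← AddCircle.coe_neg, cosFun_coe, cosFun_coe, mul_neg, Real.cos_neg]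

theorem norm_cosFun_le (n : ℤ) : ‖cosFun n‖ ≤ 1 := by
  refine (ContinuousMap.norm_le _ zero_le_one).mpr fun x => ?_
  induction x using QuotientAddGroup.induction_on with
  | H x => rw [cosFun_coe]; exact Real.abs_cos_le_one _

theorem cosFun_mul (m n : ℤ) :
    cosFun m * cosFun n = (1 / 2 : ℝ) • (cosFun (n - m) + cosFun (n + m)) := by
  ext x
  induction x using QuotientAddGroup.induction_on with
  | H x =>
    simp only [ContinuousMap.mul_apply, ContinuousMap.smul_apply, ContinuousMap.add_apply,
      cosFun_coe, smul_eq_mul, Int.cast_sub, Int.cast_add, sub_mul, add_mul, Real.cos_sub,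
      Real.cos_add]
    ring

theorem integrable_torus {F : Type*} [NormedAddCommGroup F] (f : C(Torus, F)) :
    Integrable f (AddCircle.haarAddCircle (T := 2 * π)) :=
  (map_continuous f).integrable_of_hasCompactSupport (.of_compactSpace _)

/-- The cosine coefficients `∫ f cos (n ·)` of a continuous real function on the torus, with respect
to normalized Haar measure: the coefficient of `cos (n ·)` itself is `1 / 2` for `n ≠ 0`. -/
noncomputable def cosCoeff (n : ℤ) : C(Torus, ℝ) →L[ℝ] ℝ :=
  LinearMap.mkContinuous
    { toFun := fun f => ∫ x, (f * cosFun n) x ∂(AddCircle.haarAddCircle (T := 2 * π))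
      map_add' := fun f g => by
        rw [add_mul]
        exact integral_add (integrable_torus _) (integrable_torus _)
      map_smul' := fun c f => by
        rw [smul_mul_assoc]
        exact integral_const_mul c _ } 1 (fun f => by
      refine (norm_integral_le_of_norm_le_const (C := ‖f‖ * 1) (.of_forall fun x => ?_)).trans ?_
      · refine (ContinuousMap.norm_coe_le_norm _ x).trans ((norm_mul_le _ _).trans ?_)
        gcongr
        exact norm_cosFun_le n
      · simp)

theorem cosCoeff_apply (n : ℤ) (f : C(Torus, ℝ)) :
    cosCoeff n f = ∫ x, (f * cosFun n) x ∂(AddCircle.haarAddCircle (T := 2 * π)) := rfl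

theorem abs_cosCoeff_le (n : ℤ) (f : C(Torus, ℝ)) : |cosCoeff n f| ≤ ‖f‖ := by
  have h : |cosCoeff n f| ≤ 1 * ‖f‖ := ContinuousLinearMap.le_of_opNorm_le _
    (LinearMap.mkContinuous_norm_le _ zero_le_one _ : ‖cosCoeff n‖ ≤ 1) f
  rwa [one_mul] at h

theorem cosCoeff_neg (n : ℤ) (f : C(Torus, ℝ)) : cosCoeff (-n) f = cosCoeff n f := by
  rw [cosCoeff_apply, cosFun_neg, cosCoeff_apply]

theorem cosCoeff_cosFun_mul (m n : ℤ) (f : C(Torus, ℝ)) :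
    cosCoeff n (cosFun m * f) = (1 / 2) * (cosCoeff (n - m) f + cosCoeff (n + m) f) := by
  have h : cosFun m * f * cosFun n
      = (1 / 2 : ℝ) • (f * cosFun (n - m)) + (1 / 2 : ℝ) • (f * cosFun (n + m)) := by
    rw [mul_right_comm, cosFun_mul, smul_mul_assoc, add_mul, smul_add, mul_comm f, mul_comm f]
  have hadd := integral_add (integrable_torus ((1 / 2 : ℝ) • (f * cosFun (n - m))))
    (integrable_torus ((1 / 2 : ℝ) • (f * cosFun (n + m))))
  rw [mul_add, cosCoeff_apply, h, cosCoeff_apply, cosCoeff_apply, ← integral_const_mul,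
    ← integral_const_mul]
  exact hadd

theorem fourierCoeff_neg_of_even {E : Type*} [NormedAddCommGroup E] [NormedSpace ℂ E]
    {f : Torus → E} (hf : Function.Even f) (n : ℤ) : fourierCoeff f (-n) = fourierCoeff f n := by
  rw [fourierCoeff, fourierCoeff, ← integral_neg_eq_self]
  simp only [hf _, fourier_apply, neg_neg, neg_smul, smul_neg]

theorem fourierCoeff_ofReal_of_even {f : C(Torus, ℝ)} (hf : Function.Even f) (n : ℤ) :
    fourierCoeff (fun x => (f x : ℂ)) n = (cosCoeff n f : ℂ) := by
  have hsymm : fourierCoeff (fun x => (f x : ℂ)) (-n) = fourierCoeff (fun x => (f x : ℂ)) n :=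
    fourierCoeff_neg_of_even (fun x => by rw [hf]) n
  have hc : Continuous fun x : Torus => (f x : ℂ) := by fun_prop
  have hadd := integral_add (μ := AddCircle.haarAddCircle)
    (integrable_torus ⟨_, (map_continuous (fourier (-n))).mul hc⟩)
    (integrable_torus ⟨_, (map_continuous (fourier n)).mul hc⟩)
  have hsum : (2 : ℂ) * fourierCoeff (fun x => (f x : ℂ)) n = 2 * (cosCoeff n f : ℂ) := by
    rw [two_mul]
    nth_rewrite 2 [← hsymm]
    rw [fourierCoeff, fourierCoeff, neg_neg, cosCoeff_apply, ← integral_complex_ofReal,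
      ← integral_const_mul]
    refine hadd.symm.trans (integral_congr_ae (.of_forall fun x => ?_))
    simp only [ContinuousMap.coe_mk, ContinuousMap.mul_apply, Complex.ofReal_mul, ofReal_cosFun,
      Pi.mul_apply]
    ring
  exact mul_left_cancel₀ two_ne_zero hsum

theorem eq_of_cosCoeff_eq {f g : C(Torus, ℝ)} (hf : Function.Even f) (hg : Function.Even g)
    (h : ∀ n, cosCoeff n f = cosCoeff n g) : f = g := by
  let toComplex : C(Torus, ℝ) → C(Torus, ℂ) := fun f => ⟨fun x => (f x : ℂ), by fun_prop⟩
  have hcoeff (n : ℤ) : fourierCoeff (toComplex f) n = fourierCoeff (toComplex g) n := by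
    change fourierCoeff (fun x => (f x : ℂ)) n = fourierCoeff (fun x => (g x : ℂ)) n
    rw [fourierCoeff_ofReal_of_even hf, fourierCoeff_ofReal_of_even hg, h]
  have hLp : ContinuousMap.toLp (E := ℂ) 2 AddCircle.haarAddCircle ℂ (toComplex f)
      = ContinuousMap.toLp (E := ℂ) 2 AddCircle.haarAddCircle ℂ (toComplex g) := by
    refine fourierBasis.repr.injective (lp.ext (funext fun n => ?_))
    rw [fourierBasis_repr, fourierBasis_repr, fourierCoeff_toLp, fourierCoeff_toLp, hcoeff]
  ext x
  exact Complex.ofReal_injective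
    (DFunLike.congr_fun (ContinuousMap.toLp_injective (𝕜 := ℂ) AddCircle.haarAddCircle hLp) x)

theorem cosCoeff_cosFun (k n : ℤ) :
    cosCoeff k (cosFun n) = ((if k = n then 1 else 0) + (if k = -n then 1 else 0)) / 2 := by
  have hfourier : (fun x => (cosFun n x : ℂ))
      = (2⁻¹ : ℂ) • ((fourier n : Torus → ℂ) + (fourier (-n) : Torus → ℂ)) := by
    funext x
    rw [ofReal_cosFun, Pi.smul_apply, Pi.add_apply, smul_eq_mul, div_eq_inv_mul]
  have hcoeff := fourierCoeff_ofReal_of_even (even_cosFun n) k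
  rw [hfourier, fourierCoeff.const_smul, fourierCoeff.add (integrable_torus _) (integrable_torus _),
    Pi.add_apply, fourierCoeff_fourier, fourierCoeff_fourier, Pi.single_apply, Pi.single_apply,
    smul_eq_mul] at hcoeff
  refine Complex.ofReal_injective (hcoeff.symm.trans ?_)
  split_ifs <;> norm_num

/-- The cosine series with coefficients `c n`, summed over all of `ℤ`. -/
noncomputable def cosSeries (c : ℤ → ℝ) : C(Torus, ℝ) := ∑' n, c n • cosFun n

variable {c d : ℤ → ℝ}

theorem norm_smul_cosFun_le (r : ℝ) (n : ℤ) : ‖r • cosFun n‖ ≤ |r| := by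
  rw [norm_smul, Real.norm_eq_abs]
  exact mul_le_of_le_one_right (abs_nonneg _) (norm_cosFun_le n)

theorem hasSum_cosSeries (hc : Summable c) : HasSum (fun n => c n • cosFun n) (cosSeries c) :=
  (Summable.of_norm_bounded hc.abs fun n => norm_smul_cosFun_le (c n) n).hasSum

theorem cosCoeff_cosSeries (hc : Summable c) (heven : Function.Even c) (k : ℤ) :
    cosCoeff k (cosSeries c) = c k := by
  have hpos : HasSum (fun n => if n = k then c k / 2 else 0) (c k / 2) := hasSum_ite_eq k _
  have hneg : HasSum (fun n => if n = -k then c k / 2 else 0) (c k / 2) := hasSum_ite_eq (-k) _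
  have hsum := hpos.add hneg
  rw [add_halves] at hsum
  refine ((cosCoeff k).hasSum (hasSum_cosSeries hc)).unique (hsum.congr_fun fun n => ?_)
  simp only [map_smul, smul_eq_mul, cosCoeff_cosFun, eq_comm (a := k), neg_eq_iff_eq_neg]
  split_ifs with h₁ h₂ h₂
  · rw [h₁]; ring
  · rw [h₁]; ring
  · rw [h₂, heven]; ring
  · ring

theorem hasSum_cosSeries_apply (hc : Summable c) (x : Torus) :
    HasSum (fun n => c n * cosFun n x) (cosSeries c x) :=
  (ContinuousMap.evalCLM ℝ x).hasSum (hasSum_cosSeries hc)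

theorem even_cosSeries (hc : Summable c) : Function.Even (cosSeries c) := by
  refine fun x => (hasSum_cosSeries_apply hc (-x)).unique ?_
  simpa only [even_cosFun _ x] using hasSum_cosSeries_apply hc x

theorem cosSeries_cosCoeff {f : C(Torus, ℝ)} (hf : Function.Even f)
    (hs : Summable fun n => cosCoeff n f) : (cosSeries fun n => cosCoeff n f) = f :=
  eq_of_cosCoeff_eq (even_cosSeries hs) hf fun n =>
    cosCoeff_cosSeries hs (fun n => cosCoeff_neg n f) n

theorem contDiff_cosSeries {N : ℕ}
    (hN : ∀ k ≤ N, Summable fun n : ℤ => |c n| * |(n : ℝ)| ^ k) :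
    ContDiff ℝ N fun x : ℝ => cosSeries c (x : Torus) := by
  have hc : Summable c := Summable.of_abs (by simpa using hN 0 N.zero_le)
  have hseries : (fun x : ℝ => cosSeries c (x : Torus))
      = fun x => ∑' n : ℤ, c n * Real.cos (n * x) := by
    funext x
    simpa only [cosFun_coe] using (hasSum_cosSeries_apply hc (x : Torus)).tsum_eq.symm
  rw [hseries]
  refine contDiff_tsum (N := N) (v := fun k (n : ℤ) => |c n| * |(n : ℝ)| ^ k)
    (fun n => by fun_prop) (fun k hk => hN k (by exact_mod_cast hk)) fun k n x _ => ?_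
  rw [norm_iteratedFDeriv_eq_norm_iteratedDeriv, iteratedDeriv_const_mul_field,
    iteratedDeriv_comp_const_mul (Real.contDiff_cos.of_le le_top), Real.norm_eq_abs, abs_mul,
    abs_mul, abs_pow]
  gcongr
  exact mul_le_of_le_one_right (by positivity) (Real.abs_iteratedDeriv_cos_le_one k _)

end CosineSeries

section Regularity

theorem coe_add_two_pi (x : ℝ) : ((x + 2 * π : ℝ) : Torus) = (x : Torus) :=
  AddCircle.coe_add_period (2 * π) x

theorem cosCoeff_eq_intervalIntegral (n : ℤ) (f : C(Torus, ℝ)) :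
    cosCoeff n f = (2 * π)⁻¹ * ∫ x in (0 : ℝ)..2 * π, f (x : Torus) * Real.cos (n * x) := by
  have h := AddCircle.intervalIntegral_preimage (2 * π) 0 (f * cosFun n : C(Torus, ℝ))
  rw [zero_add] at h
  rw [cosCoeff_apply, AddCircle.integral_haarAddCircle, smul_eq_mul, ← h]
  simp only [ContinuousMap.mul_apply, cosFun_coe]

theorem intervalIntegral_eq_zero_of_hasDerivAt_of_periodic {E : Type*} [NormedAddCommGroup E]
    [NormedSpace ℝ E] [CompleteSpace E] {G g : ℝ → E} {T : ℝ} (hG : Function.Periodic G T)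
    (hderiv : ∀ x, HasDerivAt G (g x) x) (hg : Continuous g) : ∫ x in (0 : ℝ)..T, g x = 0 := by
  rw [intervalIntegral.integral_eq_sub_of_hasDerivAt (fun x _ => hderiv x)
    (hg.intervalIntegrable 0 T), ← zero_add T, hG 0, sub_self]

theorem iteratedDeriv_periodic {E : Type*} [NormedAddCommGroup E] [NormedSpace ℝ E] {F : ℝ → E}
    {T : ℝ} (hF : Function.Periodic F T) (k : ℕ) : Function.Periodic (iteratedDeriv k F) T := by
  intro x
  rw [← congrFun (iteratedDeriv_comp_add_const k F T) x, funext hF]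

theorem cosCoeff_of_iteratedDeriv_two {f h : C(Torus, ℝ)}
    (hf : ContDiff ℝ 2 fun x : ℝ => f (x : Torus))
    (hh : ∀ x : ℝ, iteratedDeriv 2 (fun x : ℝ => f (x : Torus)) x = h (x : Torus)) (n : ℤ) :
    cosCoeff n h = -(n : ℝ) ^ 2 * cosCoeff n f := by
  set F : ℝ → ℝ := fun x => f (x : Torus)
  have hFper : Function.Periodic F (2 * π) := fun x => by simp only [F, coe_add_two_pi]
  have hF'per : Function.Periodic (deriv F) (2 * π) := by
    simpa only [iteratedDeriv_one] using iteratedDeriv_periodic hFper 1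
  have hlin (x : ℝ) : HasDerivAt (fun x : ℝ => (n : ℝ) * x) n x := by
    simpa using (hasDerivAt_id x).const_mul (n : ℝ)
  have hF (x : ℝ) : HasDerivAt F (deriv F x) x := (hf.differentiable two_ne_zero x).hasDerivAt
  have hF' (x : ℝ) : HasDerivAt (deriv F) (h (x : Torus)) x := by
    rw [← hh x, iteratedDeriv_succ, iteratedDeriv_one]
    exact ((hf.differentiable_deriv_two) x).hasDerivAt
  have hprim (x : ℝ) : HasDerivAt
      (fun x => Real.cos (n * x) * deriv F x + n * (Real.sin (n * x) * F x))
      (h (x : Torus) * Real.cos (n * x) + (n : ℝ) ^ 2 * (f (x : Torus) * Real.cos (n * x))) x := by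
    refine ((((Real.hasDerivAt_cos _).comp x (hlin x)).mul (hF' x)).add
      ((((Real.hasDerivAt_sin _).comp x (hlin x)).mul (hF x)).const_mul (n : ℝ))).congr_deriv ?_
    simp only [F, Function.comp_apply]
    ring
  have hper : Function.Periodic
      (fun x => Real.cos (n * x) * deriv F x + n * (Real.sin (n * x) * F x)) (2 * π) := fun x => by
    simp only [mul_add, hFper x, hF'per x, Real.cos_add_int_mul_two_pi,
      Real.sin_add_int_mul_two_pi]
  have hzero := intervalIntegral_eq_zero_of_hasDerivAt_of_periodic hper hprim (by fun_prop)
  rw [intervalIntegral.integral_add (Continuous.intervalIntegrable (by fun_prop) _ _)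
    (Continuous.intervalIntegrable (by fun_prop) _ _), intervalIntegral.integral_const_mul] at hzero
  rw [cosCoeff_eq_intervalIntegral, cosCoeff_eq_intervalIntegral]
  linear_combination (2 * π)⁻¹ * hzero

theorem exists_iteratedDeriv_two {k : ℕ} {f : C(Torus, ℝ)}
    (hf : ContDiff ℝ (k + 2 : ℕ) fun x : ℝ => f (x : Torus)) :
    ∃ h : C(Torus, ℝ), (∀ x : ℝ, iteratedDeriv 2 (fun x : ℝ => f (x : Torus)) x = h (x : Torus)) ∧
      ContDiff ℝ k (fun x : ℝ => h (x : Torus)) ∧ (Function.Even f → Function.Even h) := by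
  have hsmooth : ContDiff ℝ k (iteratedDeriv 2 fun x : ℝ => f (x : Torus)) := by
    rw [iteratedDeriv_eq_iterate]
    exact hf.iterate_deriv' k 2
  have hper : Function.Periodic (iteratedDeriv 2 fun x : ℝ => f (x : Torus)) (2 * π) :=
    iteratedDeriv_periodic (fun x => by rw [coe_add_two_pi]) 2
  refine ⟨⟨hper.lift, continuous_coinduced_dom.mpr hsmooth.continuous⟩, fun _ => rfl, hsmooth,
    fun heven x => ?_⟩
  induction x using QuotientAddGroup.induction_on with
  | H x =>
    have h := iteratedDeriv_comp_neg 2 (fun x : ℝ => f (x : Torus)) x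
    simp only [AddCircle.coe_neg, heven _, even_two.neg_one_pow, one_smul] at h
    exact h.symm

theorem exists_helmholtz (κ : ℝ) {k : ℕ} {f : C(Torus, ℝ)}
    (hf : ContDiff ℝ (k + 2 : ℕ) fun x : ℝ => f (x : Torus)) :
    ∃ v : C(Torus, ℝ), (fun x : ℝ => v (x : Torus)) = helmholtzOp κ (fun x : ℝ => f (x : Torus)) ∧
      ContDiff ℝ k (fun x : ℝ => v (x : Torus)) ∧ (Function.Even f → Function.Even v) ∧
      ∀ n, cosCoeff n v = (1 - κ * (n : ℝ) ^ 2) * cosCoeff n f := by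
  obtain ⟨h, hh, hsmooth, hheven⟩ := exists_iteratedDeriv_two hf
  have hle (m : ℕ) (hm : m ≤ k + 2) : ContDiff ℝ m fun x : ℝ => f (x : Torus) :=
    hf.of_le (by exact_mod_cast hm)
  refine ⟨f + κ • h, funext fun x => ?_, (hle k (by omega)).add (hsmooth.const_smul κ),
    fun heven => heven.add ((hheven heven).const_smul κ), fun n => ?_⟩
  · rw [helmholtzOp, hh]
    rfl
  · rw [map_add, map_smul, smul_eq_mul, cosCoeff_of_iteratedDeriv_two (hle 2 (by omega)) hh]
    ring

theorem abs_cosCoeff_le_of_contDiff {f : C(Torus, ℝ)}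
    (hf : ContDiff ℝ 2 fun x : ℝ => f (x : Torus)) :
    ∃ C : ℝ, ∀ n : ℤ, |cosCoeff n f| ≤ C * (1 + (n : ℝ) ^ 2)⁻¹ := by
  obtain ⟨v, -, -, -, hv⟩ := exists_helmholtz (-1) (k := 0) (f := f) (by simpa using hf)
  refine ⟨‖v‖, fun n => ?_⟩
  have hn : 1 - -1 * (n : ℝ) ^ 2 = 1 + (n : ℝ) ^ 2 := by ring
  have hle := abs_cosCoeff_le n v
  rw [hv, hn, abs_mul, abs_of_pos (one_add_sq_pos n)] at hle
  rwa [← div_eq_mul_inv, le_div_iff₀' (one_add_sq_pos n)]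

theorem abs_pow_le_one_add_sq_pow (x : ℝ) {j k : ℕ} (hj : j ≤ 2 * k) :
    |x| ^ j ≤ (1 + x ^ 2) ^ k := by
  have hone : 1 ≤ √(1 + x ^ 2) := Real.one_le_sqrt.mpr (le_add_of_nonneg_right (sq_nonneg x))
  calc |x| ^ j ≤ √(1 + x ^ 2) ^ j := by
        gcongr
        exact Real.abs_le_sqrt (le_add_of_nonneg_left zero_le_one)
    _ ≤ √(1 + x ^ 2) ^ (2 * k) := pow_le_pow_right₀ hone hj
    _ = (1 + x ^ 2) ^ k := by rw [pow_mul, Real.sq_sqrt (by positivity)]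

theorem contDiff_of_abs_cosCoeff_le {f : C(Torus, ℝ)} (hf : Function.Even f) {k : ℕ} {C : ℝ}
    (hC : ∀ n : ℤ, |cosCoeff n f| ≤ C * ((1 + (n : ℝ) ^ 2)⁻¹) ^ (k + 1)) :
    ContDiff ℝ (2 * k : ℕ) fun x : ℝ => f (x : Torus) := by
  have hsum : ∀ j ≤ 2 * k, Summable fun n : ℤ => |cosCoeff n f| * |(n : ℝ)| ^ j := fun j hj =>
    (summable_inv_one_add_sq.mul_left C).of_nonneg_of_le (fun n => by positivity) fun n =>
      calc |cosCoeff n f| * |(n : ℝ)| ^ j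
          ≤ (C * ((1 + (n : ℝ) ^ 2)⁻¹) ^ (k + 1)) * (1 + (n : ℝ) ^ 2) ^ k :=
            mul_le_mul (hC n) (abs_pow_le_one_add_sq_pow _ hj) (by positivity)
              ((abs_nonneg _).trans (hC n))
        _ = C * (1 + (n : ℝ) ^ 2)⁻¹ := by
          have := (one_add_sq_pos n).ne'
          rw [pow_succ, inv_pow]
          field_simp
  rw [← cosSeries_cosCoeff hf (Summable.of_abs (by simpa using hsum 0 (Nat.zero_le _)))]
  exact contDiff_cosSeries hsum

end Regularity

section FixedPoint

variable {E : Type*} [NormedAddCommGroup E] {N : E → E} {R : ℝ} {p q u v : E}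

theorem exists_eq_add_of_lipschitzOnWith [CompleteSpace E] (h0 : N 0 = 0)
    (hN : LipschitzOnWith (1 / 2) N (Metric.closedBall 0 R)) (hp : ‖p‖ ≤ R / 2) :
    ∃ u, ‖u‖ ≤ R ∧ u = p + N u := by
  have hR : 0 ≤ R := by linarith [norm_nonneg p]
  have hmem : (0 : E) ∈ Metric.closedBall 0 R := Metric.mem_closedBall_self hR
  have hmaps : MapsTo (fun u => p + N u) (Metric.closedBall 0 R) (Metric.closedBall 0 R) := by
    intro u hu
    have h := hN.norm_sub_le hu hmem
    rw [h0, sub_zero, sub_zero] at h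
    rw [mem_closedBall_zero_iff] at hu ⊢
    push_cast at h
    linarith [norm_add_le p (N u)]
  have hcontr : ContractingWith (1 / 2) (hmaps.restrict _ _ _) := by
    refine ⟨by norm_num, LipschitzWith.of_dist_le_mul fun u v => ?_⟩
    rw [Subtype.dist_eq, Subtype.dist_eq, MapsTo.val_restrict_apply, MapsTo.val_restrict_apply,
      dist_add_left]
    exact hN.dist_le_mul u u.2 v v.2
  obtain ⟨u, hu, hfix, -⟩ := hcontr.exists_fixedPoint' Metric.isClosed_closedBall.isComplete hmaps
    hmem (edist_ne_top _ _)
  exact ⟨u, mem_closedBall_zero_iff.mp hu, hfix.symm⟩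

theorem norm_sub_le_of_eq_add_of_lipschitzOnWith
    (hN : LipschitzOnWith (1 / 2) N (Metric.closedBall 0 R)) (hu : ‖u‖ ≤ R) (hv : ‖v‖ ≤ R)
    (hup : u = p + N u) (hvq : v = q + N v) : ‖u - v‖ ≤ 2 * ‖p - q‖ := by
  have hlip := hN.norm_sub_le (mem_closedBall_zero_iff.mpr hu) (mem_closedBall_zero_iff.mpr hv)
  have hsub : u - v = (p - q) + (N u - N v) := by
    nth_rewrite 1 [hup, hvq]
    abel
  have hnorm := norm_add_le (p - q) (N u - N v)
  rw [← hsub] at hnorm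
  push_cast at hlip
  linarith

end FixedPoint

section CosMultiplier

/-- The Fourier multiplier with symbol `m`, acting on cosine series; the sum is `0` by convention
unless it converges, e.g. because `m` is summable. -/
noncomputable def cosMultiplier (m : ℤ → ℝ) : C(Torus, ℝ) →L[ℝ] C(Torus, ℝ) :=
  ∑' n, m n • (cosCoeff n).smulRight (cosFun n)

variable {m d : ℤ → ℝ}

theorem norm_smul_smulRight_cosFun_le (n : ℤ) :
    ‖m n • (cosCoeff n).smulRight (cosFun n)‖ ≤ |m n| := by
  refine ContinuousLinearMap.opNorm_le_bound _ (abs_nonneg _) fun f => ?_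
  rw [_root_.smul_apply, ContinuousLinearMap.smulRight_apply, norm_smul, Real.norm_eq_abs]
  gcongr
  exact (norm_smul_cosFun_le _ n).trans (abs_cosCoeff_le n f)

theorem cosMultiplier_apply (hm : Summable m) (f : C(Torus, ℝ)) :
    cosMultiplier m f = cosSeries fun n => m n * cosCoeff n f := by
  have hsum : Summable fun n => m n • (cosCoeff n).smulRight (cosFun n) :=
    Summable.of_norm_bounded (E := C(Torus, ℝ) →L[ℝ] C(Torus, ℝ)) hm.abs
      norm_smul_smulRight_cosFun_le
  calc cosMultiplier m f = ∑' n, (m n • (cosCoeff n).smulRight (cosFun n)) f :=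
        (ContinuousLinearMap.apply ℝ C(Torus, ℝ) f).map_tsum hsum
    _ = cosSeries fun n => m n * cosCoeff n f := tsum_congr fun n => by
        rw [_root_.smul_apply, ContinuousLinearMap.smulRight_apply, smul_smul]

theorem summable_mul_cosCoeff (hm : Summable m) (f : C(Torus, ℝ)) :
    Summable fun n => m n * cosCoeff n f :=
  Summable.of_norm_bounded (hm.abs.mul_right ‖f‖) fun n => by
    rw [norm_mul, Real.norm_eq_abs, Real.norm_eq_abs]
    exact mul_le_mul_of_nonneg_left (abs_cosCoeff_le n f) (abs_nonneg _)

theorem cosCoeff_cosMultiplier (hm : Summable m) (heven : Function.Even m) (f : C(Torus, ℝ))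
    (n : ℤ) : cosCoeff n (cosMultiplier m f) = m n * cosCoeff n f := by
  rw [cosMultiplier_apply hm]
  exact cosCoeff_cosSeries (summable_mul_cosCoeff hm f)
    (fun n => by simp only [heven _, cosCoeff_neg]) n

theorem even_cosMultiplier (hm : Summable m) (f : C(Torus, ℝ)) :
    Function.Even (cosMultiplier m f) := by
  rw [cosMultiplier_apply hm]
  exact even_cosSeries (summable_mul_cosCoeff hm f)

theorem norm_cosMultiplier_le (hd : Summable d) (h : ∀ n, |m n| ≤ d n) :
    ‖cosMultiplier m‖ ≤ ∑' n, d n := by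
  rw [cosMultiplier]
  exact tsum_of_norm_bounded (E := C(Torus, ℝ) →L[ℝ] C(Torus, ℝ)) hd.hasSum fun n =>
    (norm_smul_smulRight_cosFun_le n).trans (h n)

end CosMultiplier

section RollEquation

variable {b s ε ω κ a : ℝ} {u v : C(Torus, ℝ)}

/-- The nonlinearity `b u² - s u³`. -/
noncomputable def rollNonlinearity (b s : ℝ) (u : C(Torus, ℝ)) : C(Torus, ℝ) :=
  b • u ^ 2 - s • u ^ 3

theorem rollNonlinearity_zero : rollNonlinearity b s 0 = 0 := by
  simp [rollNonlinearity]

theorem even_rollNonlinearity (hu : Function.Even u) : Function.Even (rollNonlinearity b s u) :=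
  fun x => congrArg (fun y => b * y ^ 2 - s * y ^ 3) (hu x)

/-- The eigenvalue of `(1 + κ ∂ₓ²)² - ε²` on the mode `cos (n ·)`. -/
def rollSymbol (κ ε : ℝ) (n : ℤ) : ℝ := (1 - κ * (n : ℝ) ^ 2) ^ 2 - ε ^ 2

theorem exists_helmholtz_helmholtz (κ : ℝ) (hu : ContDiff ℝ 4 fun x : ℝ => u (x : Torus))
    (heven : Function.Even u) :
    ∃ w : C(Torus, ℝ), (fun x : ℝ => w (x : Torus))
        = helmholtzOp κ (helmholtzOp κ fun x : ℝ => u (x : Torus)) ∧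
      Function.Even w ∧ ∀ n, cosCoeff n w = (1 - κ * (n : ℝ) ^ 2) ^ 2 * cosCoeff n u := by
  obtain ⟨v, hv, hvd, hve, hvc⟩ := exists_helmholtz κ (k := 2) hu
  obtain ⟨w, hw, -, hwe, hwc⟩ := exists_helmholtz κ (k := 0) (f := v) (by simpa using hvd)
  exact ⟨w, hw.trans (by rw [hv]), hwe (hve heven), fun n => by rw [hwc, hvc]; ring⟩

theorem stationary_iff_cosCoeff (hu : ContDiff ℝ 4 fun x : ℝ => u (x : Torus))
    (heven : Function.Even u) :
    (∀ x : ℝ, -helmholtzOp κ (helmholtzOp κ (fun y : ℝ => u (y : Torus))) x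
      + ε ^ 2 * u (x : Torus) + b * u (x : Torus) ^ 2 - s * u (x : Torus) ^ 3 = 0) ↔
    ∀ n : ℤ, rollSymbol κ ε n * cosCoeff n u = cosCoeff n (rollNonlinearity b s u) := by
  obtain ⟨w, hw, hweven, hwcoeff⟩ := exists_helmholtz_helmholtz κ hu heven
  have hcoeff (n : ℤ) : cosCoeff n (w - ε ^ 2 • u) = rollSymbol κ ε n * cosCoeff n u := by
    rw [map_sub, map_smul, hwcoeff, smul_eq_mul, rollSymbol, sub_mul]
  have hpointwise (x : Torus) : (w - ε ^ 2 • u) x = rollNonlinearity b s u x ↔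
      -w x + ε ^ 2 * u x + b * u x ^ 2 - s * u x ^ 3 = 0 := by
    change w x - ε ^ 2 * u x = b * u x ^ 2 - s * u x ^ 3 ↔ _
    constructor <;> intro h <;> linarith
  rw [← hw]
  constructor
  · intro h n
    rw [← hcoeff]
    congr 1
    ext x
    induction x using QuotientAddGroup.induction_on with
    | H x => exact (hpointwise x).mpr (h x)
  · intro h x
    have hsub : Function.Even ⇑(w - ε ^ 2 • u) := fun x =>
      congrArg₂ (fun y z => y - ε ^ 2 * z) (hweven x) (heven x)
    have heq : w - ε ^ 2 • u = rollNonlinearity b s u :=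
      eq_of_cosCoeff_eq hsub (even_rollNonlinearity heven) fun n => by rw [hcoeff, h]
    exact (hpointwise x).mp (by rw [heq])

theorem isRoll_iff_cosCoeff : IsRoll b s ε ω u ↔
    ContDiff ℝ 4 (fun x : ℝ => u (x : Torus)) ∧ Function.Even u ∧ u ≠ 0 ∧
      ∀ n : ℤ, rollSymbol (1 + 2 * ε * ω) ε n * cosCoeff n u
        = cosCoeff n (rollNonlinearity b s u) := by
  refine ⟨fun h => ?_, fun ⟨hsmooth, heven, hne, hcoeff⟩ =>
    ⟨hsmooth, fun x => heven x, hne, (stationary_iff_cosCoeff hsmooth heven).mpr hcoeff⟩⟩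
  have heven : Function.Even u := fun x => by
    induction x using QuotientAddGroup.induction_on with
    | H x => exact h.even x
  exact ⟨h.contDiff, heven, h.nontrivial,
    (stationary_iff_cosCoeff h.contDiff heven).mp h.stationary⟩

/-- The parameter regime in which only the modes `n = ±1` are nearly critical. -/
structure NearCritical (κ ε : ℝ) : Prop where
  nonneg : 0 ≤ ε
  le_quarter : ε ≤ 1 / 4
  abs_sub_one_le : |κ - 1| ≤ ε

theorem NearCritical.of_mem (hε : ε ∈ Ioc 0 (1 / 4)) (hω : ω ∈ Ioo (-(1 / 2)) (1 / 2)) :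
    NearCritical (1 + 2 * ε * ω) ε := by
  refine ⟨hε.1.le, hε.2, abs_le.mpr ⟨?_, ?_⟩⟩ <;> nlinarith [hε.1, hω.1, hω.2]

theorem NearCritical.three_quarters_le (h : NearCritical κ ε) : 3 / 4 ≤ κ := by
  linarith [(abs_le.mp h.abs_sub_one_le).1, h.le_quarter]

theorem NearCritical.le_four (h : NearCritical κ ε) : κ ≤ 4 := by
  linarith [(abs_le.mp h.abs_sub_one_le).2, h.le_quarter]

theorem NearCritical.le_rollSymbol (h : NearCritical κ ε) {n : ℤ} (hn : |n| ≠ 1) :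
    (1 + (n : ℝ) ^ 2) ^ 2 / 16 ≤ rollSymbol κ ε n := by
  have hε : ε ^ 2 ≤ 1 / 16 := by nlinarith [h.nonneg, h.le_quarter]
  rw [rollSymbol]
  rcases eq_or_ne n 0 with rfl | h0
  · norm_num
    linarith
  · have habs : 2 ≤ |n| := by have := abs_pos.mpr h0; omega
    have hsq : (4 : ℝ) ≤ (n : ℝ) ^ 2 := by
      rw [← sq_abs]
      exact_mod_cast (by nlinarith : (4 : ℤ) ≤ |n| ^ 2)
    have hhalf : (n : ℝ) ^ 2 / 2 ≤ κ * (n : ℝ) ^ 2 - 1 := by nlinarith [h.three_quarters_le]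
    have := pow_le_pow_left₀ (by positivity) hhalf 2
    nlinarith

theorem NearCritical.rollSymbol_pos (h : NearCritical κ ε) {n : ℤ} (hn : |n| ≠ 1) :
    0 < rollSymbol κ ε n :=
  lt_of_lt_of_le (by have := one_add_sq_pos n; positivity) (h.le_rollSymbol hn)

/-- The symbol of the inverse of `(1 + κ ∂ₓ²)² - ε²` off the critical modes `n = ±1`. -/
noncomputable def rollMultiplier (κ ε : ℝ) (n : ℤ) : ℝ :=
  if |n| = 1 then 0 else (rollSymbol κ ε n)⁻¹

theorem even_rollMultiplier : Function.Even (rollMultiplier κ ε) := fun n => by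
  simp only [rollMultiplier, rollSymbol, abs_neg, Int.cast_neg, neg_sq]

theorem NearCritical.abs_rollMultiplier_le (h : NearCritical κ ε) (n : ℤ) :
    |rollMultiplier κ ε n| ≤ 16 * ((1 + (n : ℝ) ^ 2)⁻¹) ^ 2 := by
  have := one_add_sq_pos n
  rw [rollMultiplier]
  split_ifs with hn
  · rw [abs_zero]
    positivity
  · rw [abs_of_pos (inv_pos.mpr (h.rollSymbol_pos hn))]
    refine (inv_anti₀ (by positivity) (h.le_rollSymbol hn)).trans_eq ?_
    rw [inv_div, inv_pow, div_eq_mul_inv]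

theorem NearCritical.summable_rollMultiplier (h : NearCritical κ ε) :
    Summable (rollMultiplier κ ε) :=
  Summable.of_norm_bounded (summable_inv_one_add_sq_sq.mul_left 16) h.abs_rollMultiplier_le

/-- A bound for the multipliers `rollMultiplier κ ε`, uniform over the near-critical regime. -/
noncomputable def rollBound : ℝ := ∑' n : ℤ, 16 * ((1 + (n : ℝ) ^ 2)⁻¹) ^ 2

theorem rollBound_nonneg : 0 ≤ rollBound := tsum_nonneg fun n => by positivity

theorem NearCritical.norm_cosMultiplier_rollMultiplier_le (h : NearCritical κ ε) :
    ‖cosMultiplier (rollMultiplier κ ε)‖ ≤ rollBound :=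
  norm_cosMultiplier_le (summable_inv_one_add_sq_sq.mul_left 16) h.abs_rollMultiplier_le

/-- The map `u ↦ L⁻¹ (b u² - s u³)`, where `L = (1 + κ ∂ₓ²)² - ε²` is inverted off the critical
modes. -/
noncomputable def rollMap (b s κ ε : ℝ) (u : C(Torus, ℝ)) : C(Torus, ℝ) :=
  cosMultiplier (rollMultiplier κ ε) (rollNonlinearity b s u)

theorem rollMap_zero : rollMap b s κ ε 0 = 0 := by
  rw [rollMap, rollNonlinearity_zero, map_zero]

/-- A Lipschitz constant, per unit radius, of `rollMap` on balls of radius at most one. -/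
noncomputable def rollGain (b s : ℝ) : ℝ := rollBound * (2 * |b| + 3 * |s|)

theorem rollGain_nonneg (b s : ℝ) : 0 ≤ rollGain b s := by
  have := rollBound_nonneg
  unfold rollGain
  positivity

theorem norm_smul_sub_smul_le {E : Type*} [SeminormedAddCommGroup E] [NormedSpace ℝ E] {x y : E}
    {X Y : ℝ} (b s : ℝ) (hx : ‖x‖ ≤ X) (hy : ‖y‖ ≤ Y) :
    ‖b • x - s • y‖ ≤ |b| * X + |s| * Y := by
  refine (norm_sub_le _ _).trans ?_
  rw [norm_smul, norm_smul, Real.norm_eq_abs, Real.norm_eq_abs]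
  gcongr

theorem norm_sq_add_mul_add_sq_le {u v : C(Torus, ℝ)} {U V : ℝ} (hu : ‖u‖ ≤ U) (hv : ‖v‖ ≤ V) :
    ‖u ^ 2 + u * v + v ^ 2‖ ≤ U ^ 2 + U * V + V ^ 2 :=
  norm_add₃_le.trans (add_le_add (add_le_add
    ((norm_pow_le u 2).trans (pow_le_pow_left₀ (norm_nonneg u) hu 2)) (norm_mul_le_of_le hu hv))
    ((norm_pow_le v 2).trans (pow_le_pow_left₀ (norm_nonneg v) hv 2)))

theorem norm_rollNonlinearity_sub_le (b s : ℝ) (u v : C(Torus, ℝ)) :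
    ‖rollNonlinearity b s u - rollNonlinearity b s v‖
      ≤ (|b| * (‖u‖ + ‖v‖) + |s| * (‖u‖ ^ 2 + ‖u‖ * ‖v‖ + ‖v‖ ^ 2)) * ‖u - v‖ := by
  have hfactor : rollNonlinearity b s u - rollNonlinearity b s v
      = (b • (u + v) - s • (u ^ 2 + u * v + v ^ 2)) * (u - v) := by
    simp only [rollNonlinearity, Algebra.smul_def]
    ring
  rw [hfactor]
  exact norm_mul_le_of_le (norm_smul_sub_smul_le b s (norm_add_le u v)
    (norm_sq_add_mul_add_sq_le le_rfl le_rfl)) le_rfl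

theorem NearCritical.norm_rollMap_sub_le (h : NearCritical κ ε) {R : ℝ} (hR : R ≤ 1)
    (hu : ‖u‖ ≤ R) (hv : ‖v‖ ≤ R) :
    ‖rollMap b s κ ε u - rollMap b s κ ε v‖ ≤ rollGain b s * R * ‖u - v‖ := by
  have hR0 : 0 ≤ R := (norm_nonneg u).trans hu
  have hfactor : |b| * (‖u‖ + ‖v‖) + |s| * (‖u‖ ^ 2 + ‖u‖ * ‖v‖ + ‖v‖ ^ 2)
      ≤ (2 * |b| + 3 * |s|) * R :=
    calc |b| * (‖u‖ + ‖v‖) + |s| * (‖u‖ ^ 2 + ‖u‖ * ‖v‖ + ‖v‖ ^ 2)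
        ≤ |b| * (R + R) + |s| * (R ^ 2 + R * R + R ^ 2) := by gcongr
      _ ≤ (2 * |b| + 3 * |s|) * R := by
        nlinarith [mul_nonneg (abs_nonneg s) (mul_nonneg hR0 (sub_nonneg.mpr hR))]
  rw [rollMap, rollMap, ← map_sub, rollGain]
  calc ‖cosMultiplier (rollMultiplier κ ε) (rollNonlinearity b s u - rollNonlinearity b s v)‖
      ≤ rollBound * ((2 * |b| + 3 * |s|) * R * ‖u - v‖) :=
        ContinuousLinearMap.le_of_opNorm_le_of_le _ h.norm_cosMultiplier_rollMultiplier_le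
          ((norm_rollNonlinearity_sub_le b s u v).trans (by gcongr))
    _ = rollBound * (2 * |b| + 3 * |s|) * R * ‖u - v‖ := by ring

theorem NearCritical.norm_rollMap_le (h : NearCritical κ ε) (hu : ‖u‖ ≤ 1) :
    ‖rollMap b s κ ε u‖ ≤ rollGain b s * ‖u‖ ^ 2 := by
  have hsub := h.norm_rollMap_sub_le (b := b) (s := s) hu le_rfl (v := 0) (by simp)
  rwa [rollMap_zero, sub_zero, sub_zero, mul_assoc, ← sq] at hsub

/-- A radius on which `rollMap` is a contraction with constant `1 / 2`. -/
noncomputable def rollRadius (b s : ℝ) : ℝ := (2 * rollGain b s + 1)⁻¹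

theorem rollRadius_pos (b s : ℝ) : 0 < rollRadius b s :=
  inv_pos.mpr (by linarith [rollGain_nonneg b s])

theorem rollRadius_le_one (b s : ℝ) : rollRadius b s ≤ 1 :=
  inv_le_one_of_one_le₀ (by linarith [rollGain_nonneg b s])

theorem rollGain_mul_rollRadius_le (b s : ℝ) : rollGain b s * rollRadius b s ≤ 1 / 2 := by
  have := rollGain_nonneg b s
  rw [rollRadius, ← div_eq_mul_inv, div_le_iff₀ (by linarith)]
  linarith

theorem NearCritical.lipschitzOnWith_rollMap (h : NearCritical κ ε) :
    LipschitzOnWith (1 / 2) (rollMap b s κ ε) (Metric.closedBall 0 (rollRadius b s)) := by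
  refine LipschitzOnWith.of_dist_le_mul fun u hu v hv => ?_
  rw [mem_closedBall_zero_iff] at hu hv
  rw [dist_eq_norm, dist_eq_norm]
  refine (h.norm_rollMap_sub_le (rollRadius_le_one b s) hu hv).trans ?_
  push_cast
  gcongr
  exact rollGain_mul_rollRadius_le b s

end RollEquation

section LyapunovSchmidt

variable {b s ε ω κ a : ℝ} {u : C(Torus, ℝ)}

/-- The critical part `2 a cos` of a roll of amplitude `a`. -/
noncomputable def criticalPart (a : ℝ) : C(Torus, ℝ) := (2 * a) • cosFun 1

theorem norm_criticalPart_le (a : ℝ) : ‖criticalPart a‖ ≤ 2 * |a| :=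
  (norm_smul_cosFun_le _ 1).trans_eq (by rw [abs_mul, abs_two])

theorem even_criticalPart (a : ℝ) : Function.Even (criticalPart a) :=
  (even_cosFun 1).const_smul _

theorem cosCoeff_criticalPart (a : ℝ) (n : ℤ) :
    cosCoeff n (criticalPart a) = if |n| = 1 then a else 0 := by
  simp only [criticalPart, map_smul, cosCoeff_cosFun, smul_eq_mul, abs_eq (zero_le_one' ℤ)]
  split_ifs <;> first | omega | ring

/-- The solutions of the noncritical part of the roll equation with a given critical part, i.e. of
the first half of the Lyapunov–Schmidt reduction. -/
structure IsSplitRoll (b s κ ε a : ℝ) (u : C(Torus, ℝ)) : Prop where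
  norm_le : ‖u‖ ≤ rollRadius b s
  eq_add : u = criticalPart a + rollMap b s κ ε u

theorem exists_isSplitRoll (h : NearCritical κ ε) (ha : 4 * |a| ≤ rollRadius b s) :
    ∃ u, IsSplitRoll b s κ ε a u := by
  have hp : ‖criticalPart a‖ ≤ rollRadius b s / 2 :=
    (norm_criticalPart_le a).trans (by linarith)
  obtain ⟨u, hu, hfix⟩ :=
    exists_eq_add_of_lipschitzOnWith rollMap_zero (h.lipschitzOnWith_rollMap (b := b) (s := s)) hp
  exact ⟨u, hu, hfix⟩

theorem exists_continuousOn_isSplitRoll (b s : ℝ) (h : NearCritical κ ε) :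
    ∃ U : ℝ → C(Torus, ℝ), ContinuousOn U {a | 4 * |a| ≤ rollRadius b s} ∧
      ∀ a, 4 * |a| ≤ rollRadius b s → IsSplitRoll b s κ ε a (U a) := by
  choose! U hU using fun a (ha : 4 * |a| ≤ rollRadius b s) => exists_isSplitRoll h ha
  refine ⟨U, LipschitzOnWith.continuousOn (K := 4)
    (LipschitzOnWith.of_dist_le_mul fun a ha a' ha' => ?_), hU⟩
  have hsub := norm_sub_le_of_eq_add_of_lipschitzOnWith h.lipschitzOnWith_rollMap
    (hU a ha).norm_le (hU a' ha').norm_le (hU a ha).eq_add (hU a' ha').eq_add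
  rw [criticalPart, criticalPart, ← sub_smul, ← mul_sub, ← criticalPart] at hsub
  rw [dist_eq_norm, Real.dist_eq]
  push_cast
  linarith [norm_criticalPart_le (a - a')]

theorem IsSplitRoll.norm_le_four_mul (hu : IsSplitRoll b s κ ε a u) (h : NearCritical κ ε) :
    ‖u‖ ≤ 4 * |a| := by
  have hsub := norm_sub_le_of_eq_add_of_lipschitzOnWith h.lipschitzOnWith_rollMap hu.norm_le
    (v := 0) (q := 0) (by simpa using (rollRadius_pos b s).le) hu.eq_add (by simp [rollMap_zero])
  rw [sub_zero, sub_zero] at hsub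
  linarith [norm_criticalPart_le a]

theorem IsSplitRoll.norm_sub_le (hu : IsSplitRoll b s κ ε a u) (h : NearCritical κ ε) :
    ‖u - criticalPart a‖ ≤ 16 * rollGain b s * a ^ 2 := by
  have hsub : u - criticalPart a = rollMap b s κ ε u := sub_eq_of_eq_add' hu.eq_add
  have hgain := rollGain_nonneg b s
  rw [hsub]
  calc ‖rollMap b s κ ε u‖ ≤ rollGain b s * ‖u‖ ^ 2 :=
        h.norm_rollMap_le (hu.norm_le.trans (rollRadius_le_one b s))
    _ ≤ rollGain b s * (4 * |a|) ^ 2 := by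
        gcongr
        exact hu.norm_le_four_mul h
    _ = 16 * rollGain b s * a ^ 2 := by rw [mul_pow, sq_abs]; ring

theorem IsSplitRoll.even (hu : IsSplitRoll b s κ ε a u) (h : NearCritical κ ε) :
    Function.Even u := by
  rw [hu.eq_add]
  exact (even_criticalPart _).add (even_cosMultiplier h.summable_rollMultiplier _)

theorem cosCoeff_eq_of_abs_eq_one {n : ℤ} (hn : |n| = 1) (f : C(Torus, ℝ)) :
    cosCoeff n f = cosCoeff 1 f := by
  rcases (abs_eq zero_le_one).mp hn with rfl | rfl
  · rfl
  · exact cosCoeff_neg 1 f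

theorem IsSplitRoll.cosCoeff_eq (hu : IsSplitRoll b s κ ε a u) (h : NearCritical κ ε) (n : ℤ) :
    cosCoeff n u = (if |n| = 1 then a else 0)
      + rollMultiplier κ ε n * cosCoeff n (rollNonlinearity b s u) := by
  conv_lhs => rw [hu.eq_add]
  rw [map_add, cosCoeff_criticalPart, rollMap,
    cosCoeff_cosMultiplier h.summable_rollMultiplier even_rollMultiplier]

theorem IsSplitRoll.cosCoeff_one (hu : IsSplitRoll b s κ ε a u) (h : NearCritical κ ε) :
    cosCoeff 1 u = a := by
  rw [hu.cosCoeff_eq h, rollMultiplier, if_pos abs_one, if_pos abs_one, zero_mul, add_zero]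

theorem isSplitRoll_of_cosCoeff (h : NearCritical κ ε) (heven : Function.Even u)
    (hnorm : ‖u‖ ≤ rollRadius b s)
    (hcoeff : ∀ n, rollSymbol κ ε n * cosCoeff n u = cosCoeff n (rollNonlinearity b s u)) :
    IsSplitRoll b s κ ε (cosCoeff 1 u) u := by
  refine ⟨hnorm, eq_of_cosCoeff_eq heven ((even_criticalPart _).add
    (even_cosMultiplier h.summable_rollMultiplier _)) fun n => ?_⟩
  rw [map_add, rollMap, cosCoeff_criticalPart,
    cosCoeff_cosMultiplier h.summable_rollMultiplier even_rollMultiplier, rollMultiplier]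
  split_ifs with hn
  · rw [cosCoeff_eq_of_abs_eq_one hn, zero_mul, add_zero]
  · rw [← hcoeff, inv_mul_cancel_left₀ (h.rollSymbol_pos hn).ne', zero_add]

theorem IsRoll.isSplitRoll (hu : IsRoll b s ε ω u) (h : NearCritical (1 + 2 * ε * ω) ε)
    (hnorm : ‖u‖ ≤ rollRadius b s) : IsSplitRoll b s (1 + 2 * ε * ω) ε (cosCoeff 1 u) u :=
  have ⟨_, heven, _, hcoeff⟩ := isRoll_iff_cosCoeff.mp hu
  isSplitRoll_of_cosCoeff h heven hnorm hcoeff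

theorem IsSplitRoll.abs_cosCoeff_le (hu : IsSplitRoll b s κ ε a u) (h : NearCritical κ ε)
    {j : ℕ} {C : ℝ}
    (hC : ∀ n : ℤ, |cosCoeff n (rollNonlinearity b s u)| ≤ C * ((1 + (n : ℝ) ^ 2)⁻¹) ^ j) (n : ℤ) :
    |cosCoeff n u| ≤ (2 ^ (j + 2) * |a| + 16 * C) * ((1 + (n : ℝ) ^ 2)⁻¹) ^ (j + 2) := by
  have := one_add_sq_pos n
  rw [hu.cosCoeff_eq h, add_mul]
  refine (abs_add_le _ _).trans (add_le_add ?_ ?_)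
  · split_ifs with hn
    · have hsq : (n : ℝ) ^ 2 = 1 := by rw [← sq_abs, ← Int.cast_abs, hn]; norm_num
      rw [hsq, one_add_one_eq_two, mul_right_comm, ← mul_pow, mul_inv_cancel₀ two_ne_zero,
        one_pow, one_mul]
    · rw [abs_zero]
      positivity
  · rw [abs_mul]
    calc |rollMultiplier κ ε n| * |cosCoeff n (rollNonlinearity b s u)|
        ≤ (16 * ((1 + (n : ℝ) ^ 2)⁻¹) ^ 2) * (C * ((1 + (n : ℝ) ^ 2)⁻¹) ^ j) :=
          mul_le_mul (h.abs_rollMultiplier_le n) (hC n) (abs_nonneg _) (by positivity)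
      _ = 16 * C * ((1 + (n : ℝ) ^ 2)⁻¹) ^ (j + 2) := by ring

/-- The bootstrap: bounded coefficients of the nonlinearity make `u` of class `C²`, which makes
these coefficients decay quadratically, which makes `u` of class `C⁴`. -/
theorem IsSplitRoll.contDiff (hu : IsSplitRoll b s κ ε a u) (h : NearCritical κ ε) :
    ContDiff ℝ 4 fun x : ℝ => u (x : Torus) := by
  have hgain {j : ℕ} {C : ℝ}
      (hC : ∀ n : ℤ, |cosCoeff n (rollNonlinearity b s u)| ≤ C * ((1 + (n : ℝ) ^ 2)⁻¹) ^ j) :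
      ContDiff ℝ (2 * (j + 1) : ℕ) fun x : ℝ => u (x : Torus) :=
    contDiff_of_abs_cosCoeff_le (hu.even h) (hu.abs_cosCoeff_le h hC)
  have hC2 : ContDiff ℝ 2 fun x : ℝ => u (x : Torus) :=
    hgain (j := 0) fun n => by simpa using _root_.abs_cosCoeff_le n (rollNonlinearity b s u)
  have hN2 : ContDiff ℝ 2 fun x : ℝ => rollNonlinearity b s u (x : Torus) :=
    (contDiff_const.mul (hC2.pow 2)).sub (contDiff_const.mul (hC2.pow 3))
  obtain ⟨C, hC⟩ := abs_cosCoeff_le_of_contDiff hN2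
  exact hgain (j := 1) (by simpa only [pow_one] using hC)

theorem IsSplitRoll.isRoll (hu : IsSplitRoll b s (1 + 2 * ε * ω) ε a u)
    (h : NearCritical (1 + 2 * ε * ω) ε) (ha : a ≠ 0)
    (hcrit : rollSymbol (1 + 2 * ε * ω) ε 1 * a = cosCoeff 1 (rollNonlinearity b s u)) :
    IsRoll b s ε ω u := by
  refine isRoll_iff_cosCoeff.mpr ⟨hu.contDiff h, hu.even h, fun h0 => ha ?_, fun n => ?_⟩
  · rw [← hu.cosCoeff_one h, h0, map_zero]
  · by_cases hn : |n| = 1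
    · have hsymbol : rollSymbol (1 + 2 * ε * ω) ε n = rollSymbol (1 + 2 * ε * ω) ε 1 := by
        rcases (abs_eq zero_le_one).mp hn with rfl | rfl <;> simp [rollSymbol]
      rw [cosCoeff_eq_of_abs_eq_one hn, cosCoeff_eq_of_abs_eq_one hn, hu.cosCoeff_one h, hsymbol,
        hcrit]
    · rw [hu.cosCoeff_eq h, rollMultiplier, if_neg hn, if_neg hn, zero_add,
        mul_inv_cancel_left₀ (h.rollSymbol_pos hn).ne']

end LyapunovSchmidt

section AmplitudeEquation

variable {b s ε ω κ a : ℝ} {u : C(Torus, ℝ)}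

theorem NearCritical.abs_rollMultiplier_le_sixteen (h : NearCritical κ ε) (n : ℤ) :
    |rollMultiplier κ ε n| ≤ 16 := by
  refine (h.abs_rollMultiplier_le n).trans (mul_le_of_le_one_right (by norm_num) ?_)
  exact pow_le_one₀ (by have := one_add_sq_pos n; positivity)
    (inv_le_one_of_one_le₀ (le_add_of_nonneg_right (sq_nonneg _)))

theorem NearCritical.abs_rollMultiplier_zero_sub_one_le (h : NearCritical κ ε) :
    |rollMultiplier κ ε 0 - 1| ≤ ε := by
  have hsq : 15 / 16 ≤ 1 - ε ^ 2 := by nlinarith [h.nonneg, h.le_quarter]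
  have hpos : 0 < 1 - ε ^ 2 := by linarith
  have heq : rollMultiplier κ ε 0 - 1 = ε ^ 2 / (1 - ε ^ 2) := by
    simp only [rollMultiplier, rollSymbol, abs_zero, zero_ne_one, if_false]
    norm_num
    field_simp
    ring
  rw [heq, abs_of_nonneg (by positivity), div_le_iff₀ hpos]
  nlinarith [h.nonneg, h.le_quarter]

theorem NearCritical.abs_rollMultiplier_two_sub_le (h : NearCritical κ ε) :
    |rollMultiplier κ ε 2 - 1 / 9| ≤ 2 * ε := by
  obtain ⟨hε, hε', hκ⟩ := h
  obtain ⟨hκ₁, hκ₂⟩ := abs_le.mp hκ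
  have hsymbol : 3 ≤ rollSymbol κ ε 2 := by rw [rollSymbol]; push_cast; nlinarith
  have hclose : |9 - rollSymbol κ ε 2| ≤ 28 * ε := by
    rw [rollSymbol, abs_le]
    push_cast
    constructor <;> nlinarith
  have heq : rollMultiplier κ ε 2 - 1 / 9 = (9 - rollSymbol κ ε 2) / (9 * rollSymbol κ ε 2) := by
    have : rollSymbol κ ε 2 ≠ 0 := by positivity
    rw [rollMultiplier, if_neg (by norm_num)]
    field_simp
  rw [heq, abs_div, abs_of_pos (by positivity : 0 < 9 * rollSymbol κ ε 2),
    div_le_iff₀ (by positivity)]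
  nlinarith

theorem cosCoeff_criticalPart_mul (a : ℝ) (n : ℤ) (f : C(Torus, ℝ)) :
    cosCoeff n (criticalPart a * f) = a * (cosCoeff (n - 1) f + cosCoeff (n + 1) f) := by
  rw [criticalPart, smul_mul_assoc, map_smul, cosCoeff_cosFun_mul, smul_eq_mul]
  ring

theorem cosCoeff_zero_criticalPart_sq (a : ℝ) :
    cosCoeff 0 (criticalPart a ^ 2) = 2 * a ^ 2 := by
  rw [sq, cosCoeff_criticalPart_mul, cosCoeff_criticalPart, cosCoeff_criticalPart]
  norm_num
  ring

theorem cosCoeff_one_criticalPart_sq (a : ℝ) : cosCoeff 1 (criticalPart a ^ 2) = 0 := by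
  rw [sq, cosCoeff_criticalPart_mul, cosCoeff_criticalPart, cosCoeff_criticalPart]
  norm_num

theorem cosCoeff_two_criticalPart_sq (a : ℝ) : cosCoeff 2 (criticalPart a ^ 2) = a ^ 2 := by
  rw [sq, cosCoeff_criticalPart_mul, cosCoeff_criticalPart, cosCoeff_criticalPart]
  norm_num
  ring

theorem cosCoeff_one_criticalPart_cube (a : ℝ) :
    cosCoeff 1 (criticalPart a ^ 3) = 3 * a ^ 3 := by
  rw [pow_succ', cosCoeff_criticalPart_mul, show (1 : ℤ) - 1 = 0 by norm_num,
    show (1 : ℤ) + 1 = 2 by norm_num, cosCoeff_zero_criticalPart_sq, cosCoeff_two_criticalPart_sq]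
  ring

theorem IsSplitRoll.norm_rollMap_le (hu : IsSplitRoll b s κ ε a u) (h : NearCritical κ ε) :
    ‖rollMap b s κ ε u‖ ≤ 16 * rollGain b s * a ^ 2 := by
  rw [← sub_eq_of_eq_add' hu.eq_add]
  exact hu.norm_sub_le h

/-- The constant in the cubic error of approximating `b u² - s u³` by the square of its critical
part. -/
noncomputable def quadraticError (b s : ℝ) : ℝ := 96 * |b| * rollGain b s + 64 * |s|

theorem quadraticError_nonneg (b s : ℝ) : 0 ≤ quadraticError b s := by
  have := rollGain_nonneg b s
  unfold quadraticError
  positivity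

theorem IsSplitRoll.norm_rollNonlinearity_sub_le (hu : IsSplitRoll b s κ ε a u)
    (h : NearCritical κ ε) :
    ‖rollNonlinearity b s u - b • criticalPart a ^ 2‖ ≤ quadraticError b s * |a| ^ 3 := by
  have hfactor : rollNonlinearity b s u - b • criticalPart a ^ 2
      = b • ((u - criticalPart a) * (u + criticalPart a)) - s • u ^ 3 := by
    simp only [rollNonlinearity, Algebra.smul_def]
    ring
  have hproduct : ‖(u - criticalPart a) * (u + criticalPart a)‖
      ≤ 16 * rollGain b s * a ^ 2 * (4 * |a| + 2 * |a|) :=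
    norm_mul_le_of_le (hu.norm_sub_le h)
      (norm_add_le_of_le (hu.norm_le_four_mul h) (norm_criticalPart_le a))
  have hcube : ‖u ^ 3‖ ≤ (4 * |a|) ^ 3 :=
    (norm_pow_le u 3).trans (pow_le_pow_left₀ (norm_nonneg u) (hu.norm_le_four_mul h) 3)
  rw [hfactor]
  calc ‖b • ((u - criticalPart a) * (u + criticalPart a)) - s • u ^ 3‖
      ≤ |b| * (16 * rollGain b s * a ^ 2 * (4 * |a| + 2 * |a|)) + |s| * (4 * |a|) ^ 3 :=
        norm_smul_sub_smul_le b s hproduct hcube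
    _ = quadraticError b s * |a| ^ 3 := by rw [quadraticError, ← sq_abs a]; ring

theorem IsSplitRoll.abs_cosCoeff_rollMap_sub_le (hu : IsSplitRoll b s κ ε a u)
    (h : NearCritical κ ε) {n : ℤ} {m c : ℝ} (hm : |rollMultiplier κ ε n - m| * |c| ≤ 2 * ε)
    (hc : cosCoeff n (criticalPart a ^ 2) = c * a ^ 2) :
    |cosCoeff n (rollMap b s κ ε u) - m * (b * (c * a ^ 2))|
      ≤ 16 * (quadraticError b s * |a| ^ 3) + 2 * ε * (|b| * a ^ 2) := by
  have hquad : |cosCoeff n (rollNonlinearity b s u) - b * (c * a ^ 2)|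
      ≤ quadraticError b s * |a| ^ 3 := by
    have hnorm := (_root_.abs_cosCoeff_le n _).trans (hu.norm_rollNonlinearity_sub_le h)
    rwa [map_sub, map_smul, hc, smul_eq_mul] at hnorm
  have hsplit : cosCoeff n (rollMap b s κ ε u) - m * (b * (c * a ^ 2))
      = rollMultiplier κ ε n * (cosCoeff n (rollNonlinearity b s u) - b * (c * a ^ 2))
        + (rollMultiplier κ ε n - m) * c * (b * a ^ 2) := by
    rw [rollMap, cosCoeff_cosMultiplier h.summable_rollMultiplier even_rollMultiplier]
    ring
  rw [hsplit]
  refine (abs_add_le _ _).trans (add_le_add ?_ ?_)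
  · rw [abs_mul]
    exact mul_le_mul (h.abs_rollMultiplier_le_sixteen n) hquad (abs_nonneg _) (by norm_num)
  · rw [abs_mul, abs_mul, abs_mul b, abs_sq]
    exact mul_le_mul_of_nonneg_right hm (by positivity)

theorem IsSplitRoll.abs_cosCoeff_zero_add_cosCoeff_two_sub_le (hu : IsSplitRoll b s κ ε a u)
    (h : NearCritical κ ε) :
    |cosCoeff 0 (rollMap b s κ ε u) + cosCoeff 2 (rollMap b s κ ε u) - 19 / 9 * b * a ^ 2|
      ≤ 32 * (quadraticError b s * |a| ^ 3) + 4 * ε * (|b| * a ^ 2) := by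
  have hzero := hu.abs_cosCoeff_rollMap_sub_le h (n := 0) (m := 1) (c := 2)
    (by rw [abs_two]; linarith [h.abs_rollMultiplier_zero_sub_one_le])
    (cosCoeff_zero_criticalPart_sq a)
  have htwo := hu.abs_cosCoeff_rollMap_sub_le h (n := 2) (m := 1 / 9) (c := 1)
    (by rw [abs_one, mul_one]; exact h.abs_rollMultiplier_two_sub_le)
    (by rw [cosCoeff_two_criticalPart_sq, one_mul])
  rw [abs_le] at *
  constructor <;> linarith

theorem IsSplitRoll.norm_remainder_le (hu : IsSplitRoll b s κ ε a u) (h : NearCritical κ ε) :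
    ‖b • rollMap b s κ ε u ^ 2
        - s • (rollMap b s κ ε u * (u ^ 2 + u * criticalPart a + criticalPart a ^ 2))‖
      ≤ (256 * |b| * rollGain b s ^ 2 + 448 * |s| * rollGain b s) * |a| ^ 4 := by
  have hw := hu.norm_rollMap_le h
  have hquadratic : ‖rollMap b s κ ε u ^ 2‖ ≤ (16 * rollGain b s * a ^ 2) ^ 2 :=
    (norm_pow_le _ 2).trans (pow_le_pow_left₀ (norm_nonneg _) hw 2)
  have hcubic : ‖rollMap b s κ ε u * (u ^ 2 + u * criticalPart a + criticalPart a ^ 2)‖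
      ≤ 16 * rollGain b s * a ^ 2
        * ((4 * |a|) ^ 2 + 4 * |a| * (2 * |a|) + (2 * |a|) ^ 2) :=
    norm_mul_le_of_le hw
      (norm_sq_add_mul_add_sq_le (hu.norm_le_four_mul h) (norm_criticalPart_le a))
  refine (norm_smul_sub_smul_le b s hquadratic hcubic).trans_eq ?_
  rw [← sq_abs a]
  ring

theorem IsSplitRoll.cosCoeff_one_rollNonlinearity (hu : IsSplitRoll b s κ ε a u) :
    cosCoeff 1 (rollNonlinearity b s u)
      = 2 * b * a * (cosCoeff 0 (rollMap b s κ ε u) + cosCoeff 2 (rollMap b s κ ε u))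
        - 3 * s * a ^ 3
        + cosCoeff 1 (b • rollMap b s κ ε u ^ 2
          - s • (rollMap b s κ ε u * (u ^ 2 + u * criticalPart a + criticalPart a ^ 2))) := by
  have hexpand : rollNonlinearity b s u
      = b • criticalPart a ^ 2 + (2 * b) • (criticalPart a * rollMap b s κ ε u)
        - s • criticalPart a ^ 3
        + (b • rollMap b s κ ε u ^ 2
          - s • (rollMap b s κ ε u * (u ^ 2 + u * criticalPart a + criticalPart a ^ 2))) := by
    simp only [← sub_eq_of_eq_add' hu.eq_add, rollNonlinearity, Algebra.smul_def, map_mul,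
      map_ofNat]
    ring
  conv_lhs => rw [hexpand]
  rw [map_add, map_sub, map_add, map_smul, map_smul, map_smul, cosCoeff_one_criticalPart_sq,
    cosCoeff_criticalPart_mul, cosCoeff_one_criticalPart_cube, show (1 : ℤ) - 1 = 0 by norm_num,
    show (1 : ℤ) + 1 = 2 by norm_num]
  simp only [smul_eq_mul]
  ring

/-- A constant in the error of the amplitude equation. -/
noncomputable def amplitudeError (b s : ℝ) : ℝ :=
  64 * |b| * quadraticError b s + 256 * |b| * rollGain b s ^ 2 + 448 * |s| * rollGain b s
    + 8 * b ^ 2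

theorem amplitudeError_nonneg (b s : ℝ) : 0 ≤ amplitudeError b s := by
  have := rollGain_nonneg b s
  have := quadraticError_nonneg b s
  unfold amplitudeError
  positivity

-- The quadratic term feeds the modes `0` and `2`, where `L⁻¹` is close to `1` and `1 / 9`; back in
-- the mode `1` they contribute `2 b² (2 + 1 / 9) a³ = 38 / 9 b² a³`, against `-3 s a³`.
theorem IsSplitRoll.abs_cosCoeff_one_rollNonlinearity_add_le (hu : IsSplitRoll b s κ ε a u)
    (h : NearCritical κ ε) :
    |cosCoeff 1 (rollNonlinearity b s u) + (27 * s - 38 * b ^ 2) / 9 * a ^ 3|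
      ≤ amplitudeError b s * (|a| + ε) * |a| ^ 3 := by
  have hΛ := rollGain_nonneg b s
  have hQ := quadraticError_nonneg b s
  have hε := h.nonneg
  set w₀₂ := cosCoeff 0 (rollMap b s κ ε u) + cosCoeff 2 (rollMap b s κ ε u) with hw₀₂
  set r := b • rollMap b s κ ε u ^ 2
    - s • (rollMap b s κ ε u * (u ^ 2 + u * criticalPart a + criticalPart a ^ 2)) with hr
  have hsplit : cosCoeff 1 (rollNonlinearity b s u) + (27 * s - 38 * b ^ 2) / 9 * a ^ 3
      = 2 * b * a * (w₀₂ - 19 / 9 * b * a ^ 2) + cosCoeff 1 r := by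
    rw [hu.cosCoeff_one_rollNonlinearity, ← hw₀₂, ← hr]
    ring
  rw [hsplit]
  calc |2 * b * a * (w₀₂ - 19 / 9 * b * a ^ 2) + cosCoeff 1 r|
      ≤ 2 * |b| * |a| * |w₀₂ - 19 / 9 * b * a ^ 2| + ‖r‖ := by
        refine (abs_add_le _ _).trans (add_le_add ?_ (_root_.abs_cosCoeff_le 1 r))
        rw [abs_mul, abs_mul, abs_mul, abs_two]
    _ ≤ 2 * |b| * |a| * (32 * (quadraticError b s * |a| ^ 3) + 4 * ε * (|b| * a ^ 2))
          + (256 * |b| * rollGain b s ^ 2 + 448 * |s| * rollGain b s) * |a| ^ 4 := by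
        gcongr
        · exact hu.abs_cosCoeff_zero_add_cosCoeff_two_sub_le h
        · exact hu.norm_remainder_le h
    _ = ((amplitudeError b s - 8 * b ^ 2) * |a| + 8 * b ^ 2 * ε) * |a| ^ 3 := by
        rw [amplitudeError, ← sq_abs a, ← sq_abs b]
        ring
    _ ≤ (amplitudeError b s * |a| + amplitudeError b s * ε) * |a| ^ 3 := by
        gcongr
        · linarith [sq_nonneg b]
        · rw [amplitudeError]
          exact le_add_of_nonneg_left (by positivity)
    _ = amplitudeError b s * (|a| + ε) * |a| ^ 3 := by rw [← mul_add]

end AmplitudeEquation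

section Existence

variable {b s ε ω : ℝ}

theorem exists_zero_of_pitchfork {Ψ : ℝ → ℝ} {η q a₀ : ℝ} (hη : 0 < η) (ha₀ : 0 < a₀)
    (hηq : 2 * η ≤ q * a₀ ^ 2) (hcont : ContinuousOn Ψ (Icc 0 a₀))
    (hΨ : ∀ a ∈ Icc 0 a₀, |Ψ a - (η * a - q * a ^ 3)| ≤ q / 2 * a ^ 3) :
    ∃ a ∈ Ioc 0 a₀, Ψ a = 0 := by
  have hq : 0 < q := pos_of_mul_pos_left (by linarith : 0 < q * a₀ ^ 2) (sq_nonneg a₀)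
  set a₁ := √(2 * η / (3 * q)) with ha₁
  have ha₁pos : 0 < a₁ := Real.sqrt_pos.mpr (by positivity)
  have ha₁sq : 3 * q * a₁ ^ 2 = 2 * η := by
    rw [ha₁, Real.sq_sqrt (by positivity), mul_div_cancel₀ _ (by positivity)]
  have hle : a₁ ≤ a₀ := abs_le_of_sq_le_sq' (by nlinarith [sq_nonneg a₁]) ha₀.le |>.2
  have hnonneg : 0 ≤ Ψ a₁ := by
    have hlower := (abs_le.mp (hΨ a₁ ⟨ha₁pos.le, hle⟩)).1
    have hcube : q * a₁ ^ 3 = 2 / 3 * η * a₁ := by linear_combination a₁ / 3 * ha₁sq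
    linarith
  have hnonpos : Ψ a₀ ≤ 0 := by
    have hupper := (abs_le.mp (hΨ a₀ ⟨ha₀.le, le_rfl⟩)).2
    have hcube : 2 * η * a₀ ≤ q * a₀ ^ 3 := by
      rw [pow_succ, ← mul_assoc]
      gcongr
    linarith
  obtain ⟨a, ha, hzero⟩ := intermediate_value_Icc' hle
    (hcont.mono (Icc_subset_Icc_left ha₁pos.le)) ⟨hnonpos, hnonneg⟩
  exact ⟨a, ⟨ha₁pos.trans_le ha.1, ha.2⟩, hzero⟩

theorem rollSymbol_one_neg (hε : 0 < ε) (hω : ω ∈ Ioo (-(1 / 2)) (1 / 2)) :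
    rollSymbol (1 + 2 * ε * ω) ε 1 < 0 := by
  have hfactor : rollSymbol (1 + 2 * ε * ω) ε 1 = -(ε ^ 2 * (1 - 4 * ω ^ 2)) := by
    rw [rollSymbol, Int.cast_one]
    ring
  have : 0 < 1 - 4 * ω ^ 2 := by nlinarith [hω.1, hω.2]
  rw [hfactor]
  exact neg_neg_of_pos (by positivity)

theorem neg_rollSymbol_le (κ ε : ℝ) (n : ℤ) : -rollSymbol κ ε n ≤ ε ^ 2 := by
  rw [rollSymbol]
  linarith [sq_nonneg (1 - κ * (n : ℝ) ^ 2)]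

theorem continuous_rollNonlinearity (b s : ℝ) : Continuous (rollNonlinearity b s) := by
  unfold rollNonlinearity
  fun_prop

theorem exists_isRoll_norm_le {a₀ : ℝ} (hε : ε ∈ Ioc 0 (1 / 4))
    (hω : ω ∈ Ioo (-(1 / 2)) (1 / 2)) (ha₀ : 0 < a₀) (hradius : 4 * a₀ ≤ rollRadius b s)
    (herror : amplitudeError b s * (a₀ + ε) ≤ (27 * s - 38 * b ^ 2) / 18)
    (hsq : 2 * ε ^ 2 ≤ (27 * s - 38 * b ^ 2) / 9 * a₀ ^ 2) :
    ∃ u, IsRoll b s ε ω u ∧ ‖u‖ ≤ 4 * a₀ := by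
  have h := NearCritical.of_mem hε hω
  obtain ⟨U, hcont, hU⟩ := exists_continuousOn_isSplitRoll b s h
  have hmem : ∀ a ∈ Icc 0 a₀, 4 * |a| ≤ rollRadius b s := fun a ha => by
    rw [abs_of_nonneg ha.1]
    linarith [ha.2]
  have hpitchfork : ∀ a ∈ Icc 0 a₀,
      |cosCoeff 1 (rollNonlinearity b s (U a)) + (27 * s - 38 * b ^ 2) / 9 * a ^ 3|
        ≤ (27 * s - 38 * b ^ 2) / 9 / 2 * a ^ 3 := fun a ha => by
    have hexpansion := (hU a (hmem a ha)).abs_cosCoeff_one_rollNonlinearity_add_le h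
    have herror' : amplitudeError b s * (a + ε) ≤ amplitudeError b s * (a₀ + ε) :=
      mul_le_mul_of_nonneg_left (by linarith [ha.2]) (amplitudeError_nonneg b s)
    rw [abs_of_nonneg ha.1] at hexpansion
    exact hexpansion.trans (mul_le_mul_of_nonneg_right (by linarith) (pow_nonneg ha.1 3))
  obtain ⟨a, ha, hzero⟩ := exists_zero_of_pitchfork
    (Ψ := fun a => -rollSymbol (1 + 2 * ε * ω) ε 1 * a + cosCoeff 1 (rollNonlinearity b s (U a)))
    (neg_pos.mpr (rollSymbol_one_neg hε.1 hω)) ha₀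
    ((mul_le_mul_of_nonneg_left (neg_rollSymbol_le _ _ _) two_pos.le).trans hsq)
    ((continuousOn_const.mul continuousOn_id).add ((cosCoeff 1).continuous.comp_continuousOn
      ((continuous_rollNonlinearity b s).comp_continuousOn (hcont.mono hmem))))
    (fun a ha => by convert hpitchfork a ha using 2; ring)
  have hroll := hU a (hmem a (Ioc_subset_Icc_self ha))
  refine ⟨U a, hroll.isRoll h ha.1.ne' (by linarith), (hroll.norm_le_four_mul h).trans ?_⟩
  rw [abs_of_pos ha.1]
  linarith [ha.2]

theorem eventually_nhdsGT_zero_lt {f : ℝ → ℝ} {c : ℝ} (hf : Continuous f) (h0 : f 0 < c) :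
    ∀ᶠ x in 𝓝[>] 0, f x < c :=
  ((hf.tendsto 0).mono_left nhdsWithin_le_nhds).eventually_lt_const h0

theorem eventually_forall_exists_isRoll {ρ : ℝ} (hbs : 0 < 27 * s - 38 * b ^ 2) (hρ : 0 < ρ) :
    ∀ᶠ ε in 𝓝[>] (0 : ℝ), ∀ ω ∈ Ioo (-(1 / 2) : ℝ) (1 / 2), ∃ u, IsRoll b s ε ω u ∧ ‖u‖ ≤ ρ := by
  have hlinear {k c : ℝ} (hc : 0 < c) : ∀ᶠ a in 𝓝[>] (0 : ℝ), k * a < c :=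
    eventually_nhdsGT_zero_lt (by fun_prop) (by simpa using hc)
  obtain ⟨a₀, hradius, hsmall, herror, ha₀⟩ := ((hlinear (k := 4) (rollRadius_pos b s)).and
    ((hlinear (k := 4) hρ).and ((hlinear (k := amplitudeError b s)
      (by positivity : 0 < (27 * s - 38 * b ^ 2) / 18)).and self_mem_nhdsWithin))).exists
  filter_upwards [Ioc_mem_nhdsGT (by norm_num : (0 : ℝ) < 1 / 4),
    eventually_nhdsGT_zero_lt (f := fun ε => amplitudeError b s * (a₀ + ε)) (by fun_prop)
      (by simpa using herror),
    eventually_nhdsGT_zero_lt (f := fun ε => 2 * ε ^ 2)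
      (c := (27 * s - 38 * b ^ 2) / 9 * a₀ ^ 2) (by fun_prop)
      (by rw [zero_pow two_ne_zero, mul_zero]; positivity)] with ε hε herrorε hsq ω hω
  obtain ⟨u, hu, hnorm⟩ := exists_isRoll_norm_le hε hω ha₀ hradius.le herrorε.le hsq.le
  exact ⟨u, hu, hnorm.trans hsmall.le⟩

end Existence

section Instability

variable {b s ε ω a κ : ℝ} {u : C(Torus, ℝ)}

theorem rollPotential_sub_apply (x : Torus) :
    (rollPotential b s ε u - ((ε ^ 2 : ℝ) : ℂ) • 1
        - ((2 * a * b : ℝ) : ℂ) • (fourier 1 + fourier (-1) : C(Torus, ℂ))) x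
      = (((2 * b) • (u - criticalPart a) - (3 * s) • u ^ 2) x : ℝ) := by
  change ((ε ^ 2 + 2 * b * u x - 3 * s * u x ^ 2 : ℝ) : ℂ) - ((ε ^ 2 : ℝ) : ℂ) * 1
      - ((2 * a * b : ℝ) : ℂ) * (fourier 1 x + fourier (-1) x)
    = ((2 * b * (u x - 2 * a * cosFun 1 x) - 3 * s * u x ^ 2 : ℝ) : ℂ)
  push_cast
  rw [ofReal_cosFun]
  ring

theorem IsSplitRoll.norm_rollPotential_sub_le (hu : IsSplitRoll b s κ ε a u)
    (h : NearCritical κ ε) :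
    ‖rollPotential b s ε u - ((ε ^ 2 : ℝ) : ℂ) • 1
        - ((2 * a * b : ℝ) : ℂ) • (fourier 1 + fourier (-1) : C(Torus, ℂ))‖
      ≤ (32 * |b| * rollGain b s + 48 * |s|) * a ^ 2 := by
  have hreal : ‖(2 * b) • (u - criticalPart a) - (3 * s) • u ^ 2‖
      ≤ |2 * b| * (16 * rollGain b s * a ^ 2) + |3 * s| * (4 * |a|) ^ 2 :=
    norm_smul_sub_smul_le _ _ (hu.norm_sub_le h)
      ((norm_pow_le u 2).trans (pow_le_pow_left₀ (norm_nonneg u) (hu.norm_le_four_mul h) 2))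
  have hbound : |2 * b| * (16 * rollGain b s * a ^ 2) + |3 * s| * (4 * |a|) ^ 2
      = (32 * |b| * rollGain b s + 48 * |s|) * a ^ 2 := by
    rw [abs_mul, abs_mul, abs_two, abs_of_pos (three_pos : (0 : ℝ) < 3), mul_pow, sq_abs]
    ring
  rw [← hbound]
  refine (ContinuousMap.norm_le _ ((norm_nonneg _).trans hreal)).mpr fun x => ?_
  rw [rollPotential_sub_apply, Complex.norm_real]
  exact (ContinuousMap.norm_coe_le_norm _ x).trans hreal

theorem exists_forall_hasMaximalAnalyticBranch (hb : b ≠ 0) :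
    ∃ ρ₀ > 0, ∀ ε ∈ Ioc (0 : ℝ) (1 / 4), ∀ ω ∈ Ioo (-(1 / 2) : ℝ) (1 / 2), ∀ u,
      IsRoll b s ε ω u → ‖u‖ ≤ ρ₀ →
        HasMaximalAnalyticBranch fun σ => IsUnstableEigenvalue (blochOperator b s ε ω u σ) := by
  set D := 2 * (32 * |b| * rollGain b s + 48 * |s|) + 512 * b ^ 2 with hD
  have hDnonneg : 0 ≤ D := by have := rollGain_nonneg b s; positivity
  obtain ⟨ρ₀, hradius, hsmall, hρ₀⟩ := ((eventually_nhdsGT_zero_lt (f := fun ρ => ρ) (by fun_prop)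
    (rollRadius_pos b s)).and ((eventually_nhdsGT_zero_lt (f := fun ρ => D * ρ)
      (c := 2 * |b|) (by fun_prop) (by simpa using hb)).and self_mem_nhdsWithin)).exists
  refine ⟨ρ₀, hρ₀, fun ε hε ω hω u hu hnorm => ?_⟩
  have h := NearCritical.of_mem hε hω
  have hsplit := hu.isSplitRoll h (hnorm.trans hradius.le)
  set a := cosCoeff 1 u
  have ha : 0 < |a| := by
    have := (norm_pos_iff.mpr hu.nontrivial).trans_le (hsplit.norm_le_four_mul h)
    linarith
  have hDa : D * |a| < 2 * |b| :=
    (mul_le_mul_of_nonneg_left ((abs_cosCoeff_le 1 u).trans hnorm) hDnonneg).trans_lt hsmall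
  refine hasMaximalAnalyticBranch_blochOperator h.three_quarters_le h.le_four (t := 2 * a * b) ?_
  calc 2 * ‖rollPotential b s ε u - ((ε ^ 2 : ℝ) : ℂ) • 1
          - ((2 * a * b : ℝ) : ℂ) • (fourier 1 + fourier (-1) : C(Torus, ℂ))‖
        + 128 * (2 * a * b) ^ 2
      ≤ 2 * ((32 * |b| * rollGain b s + 48 * |s|) * a ^ 2) + 128 * (2 * a * b) ^ 2 := by
        gcongr
        exact hsplit.norm_rollPotential_sub_le h
    _ = |a| * (D * |a|) := by rw [mul_left_comm |a|, ← sq, sq_abs, hD]; ring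
    _ < |a| * (2 * |b|) := by gcongr
    _ = |2 * a * b| := by rw [abs_mul, abs_mul, abs_two]; ring

end Instability

theorem lemma2p2 (b s : ℝ) (hbs : 0 < 27 * s - 38 * b ^ 2) (hb : b ≠ 0) :
    ∃ ρ₀ : ℝ, 0 < ρ₀ ∧ ∀ ρ ∈ Ioc 0 ρ₀, ∀ ε₀ : ℝ, 0 < ε₀ →
      ∃ εbar ∈ Ioc 0 ε₀, ∀ ε ∈ Ioc 0 εbar, ∀ ω ∈ Ioo (-(1 / 2) : ℝ) (1 / 2),
        (∃ u : C(Torus, ℝ), IsRoll b s ε ω u ∧ ∀ x, |u x| ≤ ρ) ∧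
        ∀ u : C(Torus, ℝ), IsRoll b s ε ω u → (∀ x, |u x| ≤ ρ) →
          ∃ (lamM : ℝ) (σbar : ℝ × ℝ),
            IsUnstableEigenvalue (blochOperator b s ε ω u σbar) lamM ∧
            (∀ (σ : ℝ × ℝ) (μ : ℝ),
              IsUnstableEigenvalue (blochOperator b s ε ω u σ) μ → μ ≤ lamM) ∧
            ∃ (N : Set (ℝ × ℝ)) (lam : ℝ × ℝ → ℝ),
              IsOpen N ∧ σbar ∈ N ∧ AnalyticOnNhd ℝ lam N ∧ lam σbar = lamM ∧
              ∀ σ ∈ N, IsUnstableEigenvalue (blochOperator b s ε ω u σ) (lam σ) := by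
  obtain ⟨ρ₀, hρ₀, hbranch⟩ := exists_forall_hasMaximalAnalyticBranch (s := s) hb
  refine ⟨ρ₀, hρ₀, fun ρ ⟨hρ, hρρ₀⟩ ε₀ hε₀ => ?_⟩
  have hnorm (u : C(Torus, ℝ)) : ‖u‖ ≤ ρ ↔ ∀ x, |u x| ≤ ρ := ContinuousMap.norm_le u hρ.le
  obtain ⟨ε₁, hε₁, hrolls⟩ :=
    mem_nhdsGT_iff_exists_Ioc_subset.mp (eventually_forall_exists_isRoll hbs hρ)
  have hεbar : 0 < min ε₀ (min ε₁ (1 / 4)) := lt_min hε₀ (lt_min hε₁ (by norm_num))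
  refine ⟨_, ⟨hεbar, min_le_left _ _⟩, fun ε ⟨hε, hle⟩ ω hω => ⟨?_, fun u hu hsup => ?_⟩⟩
  · obtain ⟨-, hle₁, -⟩ := by simpa only [le_min_iff] using hle
    obtain ⟨u, hu, hsmall⟩ := hrolls ⟨hε, hle₁⟩ ω hω
    exact ⟨u, hu, (hnorm u).mp hsmall⟩
  · obtain ⟨-, -, hle₄⟩ := by simpa only [le_min_iff] using hle
    exact hbranch ε ⟨hε, hle₄⟩ ω hω u hu (((hnorm u).mpr hsup).trans hρρ₀)
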